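/- Let $G$ be a finite group with $q=|G|$. Definitions: - A matroid $M'$ is a parallel (resp. series) extension of $M$ if some element $e$ of $M'$ lies in a circuit (resp. cocircuit) of $M'$ of cardinality $2$ and $M'\setminus e=M$ (resp. $M'/e=M$). A matroid is *series-parallel* if it is obtained from a single loop or a single coloop by a finite, possibly empty, sequence of series and parallel extensions. It is *quasi series-parallel* if all of its connected components are series-parallel (so the empty matroid is quasi series-parallel). It is *simple* if it has no circuit with at most two elements. - A *$G$-labeling* of a matroid $M$ on a ground set $E$ is a map $\phi\colon E\to G$; two $G$-labelings $\phi,\psi$ are *equivalent* if for every connected component $K$ of $M$ there is $g_K\in G$ with $\phi|_K=g_K\cdot\psi|_K$. A *$G$-labeled matroid* is a matroid together with an equivalence class of $G$-labelings of it. - Let $\mathcal C(n,k)$, $\mathcal S(n,k)$ and $\mathcal S_G(n,k)$ be the sets of, respectively, series-parallel matroids, simple quasi series-parallel matroids, and $G$-labeled simple quasi series-parallel matroids on $[n]=\{1,\dots,n\}$ of rank $k$. Let $$C(x,y)=\sum_{n\ge 1}\sum_{k=0}^n|\mathcal C(n,k)|\frac{x^n}{n!}y^k,\quad S(x,y)=\sum_{n\ge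 0}\sum_{k=0}^n|\mathcal S(n,k)|\frac{x^n}{n!}y^k,\quad S_G(x,y)=\sum_{n\ge 0}\sum_{k=0}^n|\mathcal S_G(n,k)|\frac{x^n}{n!}y^k,$$ and $A(x,y)=\exp(C(x,y))$, all regarded as formal power series in $x$ with coefficients in $\mathbb Q[y]$. For a power series $f$ in $x$ with constant coefficient $1$ and $r\in\mathbb Q$, put $f^{r}=\sum_{i\ge 0}\binom{r}{i}(f-1)^i$. **Proposition.** One has $$S_G(x,y)=\left(\frac{1}{qx+1}\,A\bigl(\log(qx+1),y\bigr)\right)^{1/q}=S(qx,y)^{1/q}.$$ -/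

import Mathlib

open scoped Polynomial PowerSeries Nat

namespace Matroid

/-- `M'` is a parallel extension of `M`: some element `e` of `M'` lies in a circuit of `M'` of
cardinality `2`, and deleting `e` gives `M`. -/
def IsParallelExtension {α : Type*} (M' M : Matroid α) : Prop :=
  ∃ e ∈ M'.E, (∃ C, M'.IsCircuit C ∧ e ∈ C ∧ C.encard = 2) ∧ M' ＼ {e} = M

/-- `M'` is a series extension of `M`: some element `e` of `M'` lies in a cocircuit of `M'` of
cardinality `2`, and contracting `e` gives `M`. -/
def IsSeriesExtension {α : Type*} (M' M : Matroid α) : Prop :=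
  ∃ e ∈ M'.E, (∃ K, M'.IsCocircuit K ∧ e ∈ K ∧ K.encard = 2) ∧ M' ／ {e} = M

/-- Series-parallel matroids: those obtained from a single loop or a single coloop by a finite,
possibly empty, sequence of series and parallel extensions. -/
inductive IsSeriesParallel {α : Type*} : Matroid α → Prop
  | loop (e : α) : IsSeriesParallel (loopyOn {e})
  | coloop (e : α) : IsSeriesParallel (freeOn {e})
  | parallel {M M' : Matroid α} (hM : IsSeriesParallel M) (h : IsParallelExtension M' M) :
      IsSeriesParallel M'
  | series {M M' : Matroid α} (hM : IsSeriesParallel M) (h : IsSeriesExtension M' M) :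
      IsSeriesParallel M'

/-- The connected component of `e` in `M`: the element `e` itself together with all elements that
lie in a common circuit with `e`. -/
def component {α : Type*} (M : Matroid α) (e : α) : Set α :=
  {f | f = e ∨ ∃ C, M.IsCircuit C ∧ e ∈ C ∧ f ∈ C}

/-- `K` is (the ground set of) a connected component of `M`. -/
def IsComponent {α : Type*} (M : Matroid α) (K : Set α) : Prop :=
  ∃ e ∈ M.E, K = M.component e

/-- A quasi series-parallel matroid: every connected component is series-parallel. -/
def IsQuasiSeriesParallel {α : Type*} (M : Matroid α) : Prop :=
  ∀ K, M.IsComponent K → (M ↾ K).IsSeriesParallel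

/-- A simple matroid: it has no circuit with at most two elements, that is, it has neither loops
nor pairs of distinct parallel elements. -/
def IsSimple {α : Type*} (M : Matroid α) : Prop :=
  ∀ C, M.IsCircuit C → 2 < C.encard

/-- Equivalence of `G`-labelings `M.E → G`: on each connected component the labelings differ by
left multiplication by an element of `G`. -/
def labelingSetoid {α : Type*} (G : Type*) [Group G] (M : Matroid α) : Setoid (M.E → G) where
  r a b := ∀ K, M.IsComponent K → ∃ g : G, ∀ e : M.E, (e : α) ∈ K → a e = g * b e
  iseqv :=
    { refl := fun a K _ => ⟨1, fun e _ => (one_mul (a e)).symm⟩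
      symm := fun h K hK => by
        obtain ⟨g, hg⟩ := h K hK
        exact ⟨g⁻¹, fun e he => by rw [hg e he, inv_mul_cancel_left]⟩
      trans := fun h h' K hK => by
        obtain ⟨g, hg⟩ := h K hK
        obtain ⟨g', hg'⟩ := h' K hK
        exact ⟨g * g', fun e he => by rw [hg e he, hg' e he, mul_assoc]⟩ }

/-- The set of series-parallel matroids on `[n]` of rank `k`. -/
def SP (n k : ℕ) : Type :=
  {M : Matroid (Fin n) // M.E = Set.univ ∧ M.IsSeriesParallel ∧ M.eRank = k}

/-- The set of simple quasi series-parallel matroids on `[n]` of rank `k`. -/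
def SimpleQSP (n k : ℕ) : Type :=
  {M : Matroid (Fin n) //
    M.E = Set.univ ∧ M.IsQuasiSeriesParallel ∧ M.IsSimple ∧ M.eRank = k}

/-- The set of `G`-labeled simple quasi series-parallel matroids on `[n]` of rank `k`: such a
matroid together with an equivalence class of `G`-labelings of it. -/
def LabeledSimpleQSP (G : Type*) [Group G] (n k : ℕ) : Type _ :=
  Σ M : SimpleQSP n k, Quotient (labelingSetoid G M.1)

end Matroid

/-- The bivariate generating function `∑ₙ ∑_{k ≤ n} a(n,k) xⁿ/n! yᵏ`, as a formal power series in
`x` whose coefficients are polynomials in `y`. -/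
noncomputable def bivariateEGF (a : ℕ → ℕ → ℕ) : ℚ[X]⟦X⟧ :=
  PowerSeries.mk fun n =>
    ∑ k ∈ Finset.range (n + 1), Polynomial.monomial k ((a n k : ℚ) / (n ! : ℚ))

/-- `C(x,y)`, counting series-parallel matroids. Its term for `n = 0` vanishes, because the ground
set of a series-parallel matroid is not empty. -/
noncomputable def genC : ℚ[X]⟦X⟧ :=
  bivariateEGF fun n k => Nat.card (Matroid.SP n k)

/-- `A(x,y) = exp(C(x,y))`. -/
noncomputable def genA : ℚ[X]⟦X⟧ :=
  (PowerSeries.exp ℚ[X]).subst genC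

/-- `S(x,y)`, counting simple quasi series-parallel matroids (the empty one included). -/
noncomputable def genS : ℚ[X]⟦X⟧ :=
  bivariateEGF fun n k => Nat.card (Matroid.SimpleQSP n k)

/-- `S_G(x,y)`, counting `G`-labeled simple quasi series-parallel matroids. -/
noncomputable def genSG (G : Type*) [Group G] : ℚ[X]⟦X⟧ :=
  bivariateEGF fun n k => Nat.card (Matroid.LabeledSimpleQSP G n k)

/-- The power `f ^ r = ∑ᵢ (r choose i) (f - 1)ⁱ` of a power series `f` with constant coefficient
`1`, for a rational exponent `r`. -/
noncomputable def ratPow (f : ℚ[X]⟦X⟧) (r : ℚ) : ℚ[X]⟦X⟧ :=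
  (PowerSeries.binomialSeries ℚ[X] r).subst (f - 1)

/-!
Let `B(x,y)` be the exponential generating function of simple series-parallel matroids. Apart from
the single loop, every series-parallel matroid arises from a simple one by replacing its elements
by parallel classes, so `C(x,y) = x + B(eˣ - 1,y)`. Hence `A(log(1+qx),y) / (1+qx) = exp(B(qx,y))`,
which is `S(qx,y)` by the exponential formula. A connected matroid on `n ≥ 1` elements has `qⁿ⁻¹`
classes of `G`-labelings, so `S_G(x,y) = exp(B(qx,y)/q)` by the exponential formula again.

The relation between `B` and `C` is obtained by adding elements one at a time. Let `T(U,E)` count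
the series-parallel matroids on `E` whose restriction to a nonempty `U ⊆ E` is simple. If `x ∉ E`,
then in such a matroid on `E ∪ {x}` the element `x` is either parallel to exactly one element of
`U`, and deleting it gives a bijection onto the matroids counted by `T(U,E)`, or the restriction
to `U ∪ {x}` is still simple; thus `T(U,E∪{x}) = |U| T(U,E) + T(U∪{x},E∪{x})`. The series
`eᵐˣ B⁽ᵐ⁾(eˣ - 1)` satisfy the same recursion for `m = |U|`. That the deletion stays
series-parallel requires an induction over the extensions building the matroid and its dual.
-/

namespace SeriesParallel

section PowerSeries

open PowerSeries

variable {A : Type*} [CommRing A]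

lemma constantCoeff_subst_of_constantCoeff_eq_zero (f : A⟦X⟧) {g : A⟦X⟧}
    (hg : constantCoeff g = 0) : constantCoeff (f.subst g) = constantCoeff f := by
  have hs : HasSubst g := .of_constantCoeff_zero' hg
  have h := constantCoeff_subst_eq_zero (a := g) hg (f - C (constantCoeff f)) (by simp)
  rw [subst_sub hs, subst_C, map_sub, sub_eq_zero] at h
  exact h.trans (by simp)

lemma one_subst {g : A⟦X⟧} (hg : HasSubst g) : (1 : A⟦X⟧).subst g = 1 := by
  rw [← coe_substAlgHom hg, map_one]

lemma constantCoeff_rescale (c : A) (f : A⟦X⟧) :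
    constantCoeff (rescale c f) = constantCoeff f := by
  rw [← coeff_zero_eq_constantCoeff_apply, coeff_rescale, pow_zero, one_mul,
    coeff_zero_eq_constantCoeff_apply]

lemma rescale_subst (c : A) {f g : A⟦X⟧} (hg : HasSubst g) :
    rescale c (f.subst g) = f.subst (rescale c g) := by
  simp only [rescale_eq_subst]
  exact subst_comp_subst_apply hg (HasSubst.smul_X' c) f

variable [Algebra ℚ A]

lemma constantCoeff_exp_subst {g : A⟦X⟧} (hg : constantCoeff g = 0) :
    constantCoeff ((exp A).subst g) = 1 := by
  rw [constantCoeff_subst_of_constantCoeff_eq_zero _ hg, constantCoeff_exp]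

lemma derivative_exp_subst {g : A⟦X⟧} (hg : constantCoeff g = 0) :
    derivative A ((exp A).subst g) = derivative A g * (exp A).subst g := by
  rw [derivative_subst (.of_constantCoeff_zero' hg), derivative_exp, mul_comm]

lemma factorial_mul_coeff_succ_exp_subst {g : A⟦X⟧} (hg : constantCoeff g = 0) (n : ℕ) :
    ((n + 1) ! : A) * coeff (n + 1) ((exp A).subst g) =
      ∑ k ∈ Finset.range (n + 1), n.choose k • ((((k + 1) ! : A) * coeff (k + 1) g) *
        (((n - k) ! : A) * coeff (n - k) ((exp A).subst g))) := by
  have h := congrArg (coeff n) (derivative_exp_subst hg)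
  rw [coeff_derivative, coeff_mul, Finset.Nat.sum_antidiagonal_eq_sum_range_succ_mk] at h
  rw [Nat.factorial_succ, Nat.cast_mul, mul_comm _ (n ! : A), mul_assoc, Nat.cast_succ,
    mul_comm (_ + 1 : A), h, Finset.mul_sum]
  refine Finset.sum_congr rfl fun k hk ↦ ?_
  rw [coeff_derivative, nsmul_eq_mul, Nat.factorial_succ,
    ← Nat.choose_mul_factorial_mul_factorial (Finset.mem_range_succ_iff.1 hk)]
  push_cast
  ring

lemma isUnit_exp_subst {g : A⟦X⟧} (hg : constantCoeff g = 0) : IsUnit ((exp A).subst g) :=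
  isUnit_iff_constantCoeff.2 (by rw [constantCoeff_exp_subst hg]; exact isUnit_one)

lemma eq_exp_subst_of_derivative_eq {f g : A⟦X⟧} (hg : constantCoeff g = 0)
    (hf : constantCoeff f = 1) (h : derivative A f = derivative A g * f) :
    f = (exp A).subst g := by
  have := IsAddTorsionFree.of_module_rat A
  obtain ⟨v, hv⟩ := (isUnit_exp_subst hg).exists_right_inv
  have hv₀ : constantCoeff v = 1 := by
    simpa [constantCoeff_exp_subst hg] using congrArg constantCoeff hv
  have hdv : derivative A v = -(derivative A g * v) := by
    have := congrArg (derivative A) hv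
    rw [Derivation.leibniz, derivative_exp_subst hg, derivative_one, smul_eq_mul, smul_eq_mul]
      at this
    linear_combination v * this - (derivative A v + derivative A g * v) * hv
  have hfv : f * v = 1 := derivative.ext
    (by rw [Derivation.leibniz, h, hdv, derivative_one, smul_eq_mul, smul_eq_mul]; ring)
    (by rw [map_mul, hf, hv₀, map_one, mul_one])
  linear_combination (exp A).subst g * hfv - f * hv

lemma exp_subst_add {f g : A⟦X⟧} (hf : constantCoeff f = 0) (hg : constantCoeff g = 0) :
    (exp A).subst (f + g) = (exp A).subst f * (exp A).subst g := by
  refine (eq_exp_subst_of_derivative_eq (by simp [hf, hg]) ?_ ?_).symm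
  · rw [map_mul, constantCoeff_exp_subst hf, constantCoeff_exp_subst hg, mul_one]
  · rw [Derivation.leibniz, derivative_exp_subst hf, derivative_exp_subst hg, map_add,
      smul_eq_mul, smul_eq_mul]
    ring

lemma one_add_X_mul_derivative_log : (1 + X) * derivative A (log A) = 1 := by
  rw [deriv_log]
  ext n
  cases n with
  | zero => simp [coeff_zero_eq_constantCoeff_apply]
  | succ n =>
    rw [add_mul, one_mul, map_add, coeff_succ_X_mul, coeff_mk, coeff_mk, ← map_add, pow_succ]
    simp [coeff_one]

lemma exp_subst_logOf {f : A⟦X⟧} (hf : constantCoeff f = 1) : (exp A).subst (logOf f) = f := by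
  have hs : HasSubst (f - 1) := .of_constantCoeff_zero' (by simp [hf])
  refine (eq_exp_subst_of_derivative_eq (constantCoeff_logOf hf) hf ?_).symm
  have h := congrArg (subst (f - 1)) (one_add_X_mul_derivative_log (A := A))
  rw [subst_mul hs, subst_add hs, subst_X hs, one_subst hs, add_sub_cancel] at h
  rw [logOf_eq, derivative_subst hs, map_sub, derivative_one]
  linear_combination -(derivative A f) * h

lemma one_add_X_mul_derivative_binomialSeries (r : ℚ) :
    (1 + X) * derivative A (binomialSeries A r) = r • binomialSeries A r := by
  have hchoose (n : ℕ) : Ring.choose r (n + 1) * (n + 1) = Ring.choose r n * (r - n) := by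
    have h := Ring.choose_smul_choose r n.le_succ
    rw [n.succ_eq_add_one, n.choose_succ_self_right, n.add_sub_cancel_left, Ring.choose_one_right,
      nsmul_eq_mul] at h
    rw [← h]
    push_cast
    ring
  have hcoeff (n : ℕ) : coeff n (binomialSeries A r) = algebraMap ℚ A (Ring.choose r n) := by
    rw [binomialSeries_coeff, Algebra.smul_def, mul_one]
  ext n
  have h := congrArg (algebraMap ℚ A) (hchoose n)
  rw [add_mul, one_mul, map_add, coeff_derivative, LinearMap.map_smul_of_tower,
    Algebra.smul_def, hcoeff, hcoeff]
  push_cast at h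
  rw [h]
  cases n with
  | zero => simp [mul_comm]
  | succ n =>
    rw [coeff_succ_X_mul, coeff_derivative, hcoeff]
    push_cast
    ring

lemma binomialSeries_subst_exp_subst {g : A⟦X⟧} (hg : constantCoeff g = 0) (r : ℚ) :
    (binomialSeries A r).subst ((exp A).subst g - 1) = (exp A).subst (r • g) := by
  have hf := constantCoeff_exp_subst hg
  have hs : HasSubst ((exp A).subst g - 1) := .of_constantCoeff_zero' (by simp [hf])
  refine eq_exp_subst_of_derivative_eq (by simp [hg]) ?_ ?_
  · rw [constantCoeff_subst_of_constantCoeff_eq_zero _ (by simp [hf]),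
      binomialSeries_constantCoeff]
  · have h := congrArg (subst ((exp A).subst g - 1))
      (one_add_X_mul_derivative_binomialSeries (A := A) r)
    rw [subst_mul hs, subst_add hs, subst_X hs, one_subst hs, add_sub_cancel, subst_smul hs] at h
    rw [derivative_subst hs, map_sub, derivative_one, sub_zero, derivative_exp_subst hg,
      Derivation.map_smul_of_tower, smul_mul_assoc, ← mul_smul_comm, ← h]
    ring

end PowerSeries

section ExpIter

open PowerSeries

variable {A : Type*} [CommRing A] [Algebra ℚ A]

/-- The series `eᵐˣ · B⁽ᵐ⁾(eˣ - 1)`. If `B` counts simple structures, it counts the structures that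
are simple on `m` distinguished elements, by the number of remaining elements. -/
noncomputable def expIter (B : A⟦X⟧) (m : ℕ) : A⟦X⟧ :=
  exp A ^ m * ((derivative A)^[m] B).subst (exp A - 1)

lemma derivative_expIter (B : A⟦X⟧) (m : ℕ) :
    derivative A (expIter B m) = (m : A⟦X⟧) * expIter B m + expIter B (m + 1) := by
  rw [expIter, expIter, Derivation.leibniz, derivative_subst HasSubst.exp_sub_one,
    derivative_pow, derivative_exp, map_sub, derivative_one, derivative_exp,
    Function.iterate_succ_apply', smul_eq_mul, smul_eq_mul]
  cases m with
  | zero => simp only [pow_zero, Nat.cast_zero]; ring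
  | succ m => rw [Nat.add_sub_cancel]; ring

lemma constantCoeff_expIter (B : A⟦X⟧) (m : ℕ) :
    constantCoeff (expIter B m) = (m ! : A) * coeff m B := by
  rw [expIter, map_mul, constantCoeff_subst_of_constantCoeff_eq_zero _
    (by rw [map_sub, constantCoeff_exp, map_one, sub_self]), map_pow, constantCoeff_exp, one_pow,
    one_mul, constantCoeff_iterate_derivative]

end ExpIter

open Set Matroid

variable {α β : Type*}

section Components

variable {M : Matroid α} {e f g : α} {C C₁ C₂ K : Set α}

lemma mem_component_self (M : Matroid α) (e : α) : e ∈ M.component e := Or.inl rfl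

lemma mem_component_of_isCircuit (hC : M.IsCircuit C) (he : e ∈ C) (hf : f ∈ C) :
    f ∈ M.component e := Or.inr ⟨C, hC, he, hf⟩

lemma mem_component_symm (h : f ∈ M.component e) : e ∈ M.component f := by
  rcases h with rfl | ⟨C, hC, he, hf⟩
  · exact mem_component_self M f
  · exact mem_component_of_isCircuit hC hf he

lemma component_subset_ground (he : e ∈ M.E) : M.component e ⊆ M.E := by
  rintro f (rfl | ⟨C, hC, -, hf⟩)
  · exact he
  · exact hC.subset_ground hf

lemma exists_isCircuit_mem_not_subset (h₁ : M.IsCircuit C₁) (h₂ : M.IsCircuit C₂)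
    (hf₁ : f ∈ C₁) (hf₂ : f ∈ C₂) (he₁ : e ∈ C₁) (he₂ : e ∉ C₂) :
    ∃ C ⊆ (C₁ ∪ C₂) \ {f}, M.IsCircuit C ∧ e ∈ C ∧ (C \ C₁).Nonempty := by
  obtain ⟨C, hCss, hC, he⟩ := h₁.strong_elimination h₂ hf₁ hf₂ he₁ he₂
  refine ⟨C, hCss, hC, he, sdiff_nonempty.2 fun hCC₁ ↦ ?_⟩
  exact (hCss (hC.eq_of_subset_isCircuit h₁ hCC₁ ▸ hf₁)).2 rfl

lemma exists_isCircuit_of_inter_nonempty [M.Finitary] (h₁ : M.IsCircuit C₁)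
    (h₂ : M.IsCircuit C₂) (hne : (C₁ ∩ C₂).Nonempty) (he : e ∈ C₁) (hg : g ∈ C₂) :
    ∃ C, M.IsCircuit C ∧ e ∈ C ∧ g ∈ C := by
  induction hn : (C₁ ∪ C₂).ncard using Nat.strong_induction_on generalizing C₁ C₂ with
  | _ n ih =>
  by_cases heC₂ : e ∈ C₂
  · exact ⟨C₂, h₂, heC₂, hg⟩
  by_cases hgC₁ : g ∈ C₁
  · exact ⟨C₁, h₁, he, hgC₁⟩
  obtain ⟨f, hf₁, hf₂⟩ := hne
  obtain ⟨C₃, hC₃, h₃, he₃, b, hb₃, hb₁⟩ :=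
    exists_isCircuit_mem_not_subset h₁ h₂ hf₁ hf₂ he heC₂
  obtain ⟨C₄, hC₄, h₄, hg₄, a, ha₄, ha₂⟩ :=
    exists_isCircuit_mem_not_subset h₂ h₁ hf₂ hf₁ hg hgC₁
  rw [union_comm] at hC₄
  have hfin : (C₁ ∪ C₂).Finite := h₁.finite.union h₂.finite
  have hlt {D : Set α} {x : α} (hD : D ⊆ C₁ ∪ C₂) (hx : x ∈ C₁ ∪ C₂) (hxD : x ∉ D) :
      D.ncard < n :=
    hn ▸ ncard_lt_ncard ⟨hD, fun h ↦ hxD (h hx)⟩ hfin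
  by_cases ha₃ : a ∈ C₃
  · refine ih _ (hlt (x := f) ?_ (Or.inl hf₁) ?_) h₃ h₄ ⟨a, ha₃, ha₄⟩ he₃ hg₄ rfl
    · exact union_subset (hC₃.trans sdiff_subset) (hC₄.trans sdiff_subset)
    · exact fun h ↦ h.elim (fun h ↦ (hC₃ h).2 rfl) (fun h ↦ (hC₄ h).2 rfl)
  · refine ih _ (hlt (x := a) ?_ (hC₄ ha₄).1 ?_) h₃ h₂ ?_ he₃ hg rfl
    · exact union_subset (hC₃.trans sdiff_subset) subset_union_right
    · exact fun h ↦ h.elim ha₃ ha₂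
    · exact ⟨b, hb₃, (hC₃ hb₃).1.resolve_left hb₁⟩

lemma mem_component_trans [M.Finitary] (h : f ∈ M.component e) (h' : g ∈ M.component f) :
    g ∈ M.component e := by
  rcases h with rfl | ⟨C, hC, he, hf⟩
  · exact h'
  rcases h' with rfl | ⟨D, hD, hf', hg⟩
  · exact mem_component_of_isCircuit hC he hf
  · exact Or.inr (exists_isCircuit_of_inter_nonempty hC hD ⟨f, hf, hf'⟩ he hg)

lemma component_eq_of_mem [M.Finitary] (h : f ∈ M.component e) :
    M.component f = M.component e :=
  Subset.antisymm (fun _ hx ↦ mem_component_trans h hx)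
    fun _ hx ↦ mem_component_trans (mem_component_symm h) hx

lemma subset_component_of_isCircuit [M.Finitary] (hC : M.IsCircuit C) (hf : f ∈ C)
    (h : f ∈ M.component e) : C ⊆ M.component e :=
  fun _ hx ↦ mem_component_trans h (mem_component_of_isCircuit hC hf hx)

lemma subset_ground_of_isComponent (hK : M.IsComponent K) : K ⊆ M.E := by
  obtain ⟨e, he, rfl⟩ := hK
  exact component_subset_ground he

/-- A connected matroid: the component of every element is the whole ground set. The empty matroid
is connected in this sense. -/
def IsConn (M : Matroid α) : Prop := ∀ e ∈ M.E, M.component e = M.E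

lemma IsConn.exists_isCircuit (hM : IsConn M) (he : e ∈ M.E) (hf : f ∈ M.E) (hef : e ≠ f) :
    ∃ C, M.IsCircuit C ∧ e ∈ C ∧ f ∈ C :=
  ((hM e he).symm ▸ hf : f ∈ M.component e).resolve_left hef.symm

lemma IsConn.isNonloop (hM : IsConn M) (hE : M.E.Nontrivial) (he : e ∈ M.E) : M.IsNonloop e := by
  obtain ⟨f, hf, hfe⟩ := hE.exists_ne e
  obtain ⟨C, hC, heC, hfC⟩ := hM.exists_isCircuit he hf hfe.symm
  exact hC.isNonloop_of_mem ⟨e, heC, f, hfC, hfe.symm⟩ heC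

lemma isConn_of_component_eq [M.Finitary] (h : M.component e = M.E) : IsConn M :=
  fun f hf ↦ by rw [component_eq_of_mem (h ▸ hf), h]

lemma restrict_component_eq (hK : K ⊆ M.E) (he : M.component e ⊆ K) :
    (M ↾ K).component e = M.component e := by
  ext f
  constructor
  · rintro (rfl | ⟨C, hC, heC, hfC⟩)
    · exact mem_component_self M _
    · exact mem_component_of_isCircuit ((restrict_isCircuit_iff hK).1 hC).1 heC hfC
  · rintro (rfl | ⟨C, hC, heC, hfC⟩)
    · exact mem_component_self _ _
    · have hCK : C ⊆ K := fun x hx ↦ he (mem_component_of_isCircuit hC heC hx)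
      exact mem_component_of_isCircuit ((restrict_isCircuit_iff hK).2 ⟨hC, hCK⟩) heC hfC

lemma isConn_restrict_component [M.Finitary] (he : e ∈ M.E) : IsConn (M ↾ M.component e) :=
  isConn_of_component_eq (restrict_component_eq (component_subset_ground he) Subset.rfl)

lemma IsConn.isQuasiSeriesParallel_iff (hM : IsConn M) (hne : M.E.Nonempty) :
    M.IsQuasiSeriesParallel ↔ M.IsSeriesParallel := by
  have hcomp {K : Set α} : M.IsComponent K ↔ K = M.E :=
    ⟨fun ⟨e, he, hK⟩ ↦ hK.trans (hM e he),
      fun hK ↦ hne.imp fun e he ↦ ⟨he, hK.trans (hM e he).symm⟩⟩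
  simp only [IsQuasiSeriesParallel, hcomp, forall_eq, restrict_ground_eq_self]

end Components

section DisjointSum

variable {M N : Matroid α} {e : α} {C K L X : Set α}

lemma disjointSum_restrict_left (h : Disjoint M.E N.E) (hX : X ⊆ M.E) :
    (M.disjointSum N h) ↾ X = M ↾ X := by
  refine ext_indep rfl fun I (hI : I ⊆ X) ↦ ?_
  have hIM : I ∩ M.E = I := inter_eq_self_of_subset_left (hI.trans hX)
  have hIN : I ∩ N.E = ∅ := (h.mono_left (hI.trans hX)).inter_eq
  simp only [restrict_indep_iff, disjointSum_indep_iff, hIM, hIN, empty_indep, true_and,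
    and_congr_left_iff, and_iff_left_iff_imp]
  exact fun _ _ ↦ (hI.trans hX).trans subset_union_left

lemma disjointSum_restrict_right (h : Disjoint M.E N.E) (hX : X ⊆ N.E) :
    (M.disjointSum N h) ↾ X = N ↾ X := by
  rw [disjointSum_comm, disjointSum_restrict_left _ hX]

lemma disjointSum_isCircuit_iff (h : Disjoint M.E N.E) :
    (M.disjointSum N h).IsCircuit C ↔ M.IsCircuit C ∨ N.IsCircuit C := by
  have hleft {D : Set α} : M.IsCircuit D ↔ (M.disjointSum N h).IsCircuit D ∧ D ⊆ M.E := by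
    rw [← restrict_isCircuit_iff (by simp), disjointSum_restrict_left h Subset.rfl,
      restrict_ground_eq_self]
  have hright {D : Set α} : N.IsCircuit D ↔ (M.disjointSum N h).IsCircuit D ∧ D ⊆ N.E := by
    rw [← restrict_isCircuit_iff (by simp), disjointSum_restrict_right h Subset.rfl,
      restrict_ground_eq_self]
  refine ⟨fun hC ↦ ?_, fun hC ↦ hC.elim (fun h' ↦ (hleft.1 h').1) (fun h' ↦ (hright.1 h').1)⟩
  by_cases hCM : M.Indep (C ∩ M.E)
  · have hCN : ¬ N.Indep (C ∩ N.E) := fun hCN ↦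
      hC.not_indep (disjointSum_indep_iff.2 ⟨hCM, hCN, by simpa using hC.subset_ground⟩)
    obtain ⟨D, hDC, hD⟩ := ((not_indep_iff inter_subset_right).1 hCN).exists_isCircuit_subset
    have hDC' := (hright.1 hD).1.eq_of_subset_isCircuit hC (hDC.trans inter_subset_left)
    exact Or.inr (hDC' ▸ hD)
  · obtain ⟨D, hDC, hD⟩ := ((not_indep_iff inter_subset_right).1 hCM).exists_isCircuit_subset
    have hDC' := (hleft.1 hD).1.eq_of_subset_isCircuit hC (hDC.trans inter_subset_left)
    exact Or.inl (hDC' ▸ hD)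

lemma disjointSum_component_left (h : Disjoint M.E N.E) (he : e ∈ M.E) :
    (M.disjointSum N h).component e = M.component e := by
  ext f
  have hN (C : Set α) : N.IsCircuit C → e ∉ C :=
    fun hC heC ↦ h.notMem_of_mem_left he (hC.subset_ground heC)
  simp only [component, disjointSum_isCircuit_iff, mem_ofPred_eq]
  grind

lemma disjointSum_component_right (h : Disjoint M.E N.E) (he : e ∈ N.E) :
    (M.disjointSum N h).component e = N.component e := by
  rw [disjointSum_comm, disjointSum_component_left _ he]

lemma disjointSum_isComponent_iff (h : Disjoint M.E N.E) :
    (M.disjointSum N h).IsComponent K ↔ M.IsComponent K ∨ N.IsComponent K := by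
  simp only [IsComponent, disjointSum_ground_eq, mem_union, or_and_right, exists_or]
  exact or_congr
    (exists_congr fun e ↦ and_congr_right fun he ↦ by rw [disjointSum_component_left h he])
    (exists_congr fun e ↦ and_congr_right fun he ↦ by rw [disjointSum_component_right h he])

lemma disjointSum_isQuasiSeriesParallel_iff (h : Disjoint M.E N.E) :
    (M.disjointSum N h).IsQuasiSeriesParallel ↔
      M.IsQuasiSeriesParallel ∧ N.IsQuasiSeriesParallel := by
  simp only [IsQuasiSeriesParallel, disjointSum_isComponent_iff, or_imp, forall_and]
  refine and_congr (forall₂_congr fun K hK ↦ ?_) (forall₂_congr fun K hK ↦ ?_)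
  · rw [disjointSum_restrict_left h (subset_ground_of_isComponent hK)]
  · rw [disjointSum_restrict_right h (subset_ground_of_isComponent hK)]

lemma disjointSum_isSimple_iff (h : Disjoint M.E N.E) :
    (M.disjointSum N h).IsSimple ↔ M.IsSimple ∧ N.IsSimple := by
  simp only [IsSimple, disjointSum_isCircuit_iff, or_imp, forall_and]

lemma eRank_disjointSum (h : Disjoint M.E N.E) :
    (M.disjointSum N h).eRank = M.eRank + N.eRank := by
  obtain ⟨B, hB⟩ := (M.disjointSum N h).exists_isBase
  obtain ⟨hBM, hBN, hBE⟩ := disjointSum_isBase_iff.1 hB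
  rw [← hB.encard_eq_eRank, ← hBM.encard_eq_eRank, ← hBN.encard_eq_eRank,
    ← encard_union_eq (h.mono inter_subset_right inter_subset_right), ← inter_union_distrib_left,
    inter_eq_self_of_subset_left hBE]

lemma disjointSum_restrict_of_component_eq [M.Finitary] (h : Disjoint (M ↾ K).E (M ↾ L).E)
    (hE : M.E = K ∪ L) (hK : M.component e = K) : (M ↾ K).disjointSum (M ↾ L) h = M := by
  refine ext_indep (by simp [hE]) fun I hI ↦ ?_
  simp only [disjointSum_ground_eq, restrict_ground_eq] at hI
  simp only [disjointSum_indep_iff, restrict_indep_iff, restrict_ground_eq, inter_subset_right,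
    and_true, hI]
  refine ⟨fun ⟨h₁, h₂⟩ ↦ ?_, fun h ↦ ⟨h.subset inter_subset_left, h.subset inter_subset_left⟩⟩
  refine (indep_iff_forall_subset_not_isCircuit (hE ▸ hI)).2 fun C hCI hC ↦ ?_
  have hCK {x : α} (hxC : x ∈ C) (hxK : x ∈ K) : C ⊆ K :=
    hK ▸ subset_component_of_isCircuit hC hxC (hK ▸ hxK)
  obtain ⟨x, hx⟩ := hC.nonempty
  by_cases hxK : x ∈ K
  · exact hC.not_indep (h₁.subset (subset_inter hCI (hCK hx hxK)))
  · exact hC.not_indep (h₂.subset (subset_inter hCI fun y hy ↦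
      (hI (hCI hy)).resolve_left fun hyK ↦ hxK (hCK hy hyK hx)))

end DisjointSum

section Map

variable {M : Matroid α} {e : α} {f : α → β} {C : Set α}

lemma map_image_isCircuit_iff (hf : InjOn f M.E) (hC : C ⊆ M.E) :
    (M.map f hf).IsCircuit (f '' C) ↔ M.IsCircuit C := by
  have hdep {D : Set α} (hD : D ⊆ M.E) : (M.map f hf).Dep (f '' D) ↔ M.Dep D := by
    rw [Dep, map_image_indep_iff hD, map_ground, Dep, and_iff_left (image_mono hD),
      and_iff_left hD]
  rw [isCircuit_iff, isCircuit_iff, hdep hC, and_congr_right_iff]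
  refine fun _ ↦ ⟨fun h D hD hDC ↦ ?_, fun h D hD hDC ↦ ?_⟩
  · exact (hf.image_eq_image_iff hD.subset_ground hC).1
      (h ((hdep hD.subset_ground).2 hD) (image_mono hDC))
  · obtain ⟨D, hDC', rfl⟩ := subset_image_iff.1 hDC
    rw [h ((hdep (hDC'.trans hC)).1 hD) hDC']

lemma map_isCircuit_iff (hf : InjOn f M.E) {C : Set β} :
    (M.map f hf).IsCircuit C ↔ ∃ C₀, M.IsCircuit C₀ ∧ f '' C₀ = C := by
  constructor
  · intro hC
    obtain ⟨C₀, hC₀, rfl⟩ := subset_image_iff.1 hC.subset_ground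
    exact ⟨C₀, (map_image_isCircuit_iff hf hC₀).1 hC, rfl⟩
  · rintro ⟨C₀, hC₀, rfl⟩
    exact (map_image_isCircuit_iff hf hC₀.subset_ground).2 hC₀

lemma map_isSimple_iff (hf : InjOn f M.E) : (M.map f hf).IsSimple ↔ M.IsSimple := by
  simp only [IsSimple, map_isCircuit_iff, forall_exists_index, and_imp, forall_apply_eq_imp_iff₂]
  exact forall₂_congr fun C hC ↦ by rw [(hf.mono hC.subset_ground).encard_image]

lemma map_delete (hf : InjOn f M.E) (he : e ∈ M.E) :
    (M.map f hf) ＼ {f e} = (M ＼ {e}).map f (hf.mono sdiff_subset) := by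
  refine ext_indep ?_ fun I hI ↦ ?_
  · rw [delete_ground, map_ground, map_ground, delete_ground, hf.image_sdiff,
      inter_eq_self_of_subset_right (singleton_subset_iff.2 he), image_singleton]
  simp only [deleteElem_indep_iff, map_indep_iff]
  constructor
  · rintro ⟨⟨J, hJ, rfl⟩, heJ⟩
    exact ⟨J, ⟨hJ, fun h ↦ heJ (mem_image_of_mem f h)⟩, rfl⟩
  · rintro ⟨J, ⟨hJ, heJ⟩, rfl⟩
    exact ⟨⟨J, hJ, rfl⟩, (hf.mem_image_iff hJ.subset_ground he).not.2 heJ⟩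

lemma map_map_of_leftInvOn {g : β → α} (hf : InjOn f M.E) (h : LeftInvOn g f M.E)
    (hg : InjOn g (M.map f hf).E) : (M.map f hf).map g hg = M := by
  have himage {I : Set α} (hI : I ⊆ M.E) : g '' (f '' I) = I := (h.mono hI).image_image
  refine ext_indep (himage Subset.rfl) fun I _ ↦ ?_
  simp only [map_indep_iff]
  constructor
  · rintro ⟨_, ⟨J, hJ, rfl⟩, rfl⟩
    rwa [himage hJ.subset_ground]
  · exact fun hI ↦ ⟨f '' I, ⟨I, hI, rfl⟩, (himage hI.subset_ground).symm⟩

end Map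

section Extensions

variable {M M' N : Matroid α} {e : α}

lemma exists_pair_iff_of_encard_eq_two {P : Set α → Prop} {Q : α → Prop} {E : Set α}
    (hE : ∀ C, P C → C ⊆ E) :
    (∃ e ∈ E, (∃ C, P C ∧ e ∈ C ∧ C.encard = 2) ∧ Q e) ↔ ∃ a b, a ≠ b ∧ P {a, b} ∧ Q a := by
  constructor
  · rintro ⟨a, -, ⟨C, hC, haC, hC₂⟩, ha⟩
    obtain ⟨x, y, hxy, rfl⟩ := encard_eq_two.1 hC₂
    rcases haC with rfl | rfl
    · exact ⟨_, y, hxy, hC, ha⟩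
    · exact ⟨_, x, hxy.symm, pair_comm _ _ ▸ hC, ha⟩
  · rintro ⟨a, b, hab, hC, ha⟩
    exact ⟨a, hE _ hC (mem_insert a _), ⟨_, hC, mem_insert a _, encard_pair hab⟩, ha⟩

lemma isParallelExtension_iff :
    IsParallelExtension M' M ↔ ∃ a b, a ≠ b ∧ M'.IsCircuit {a, b} ∧ M' ＼ {a} = M :=
  exists_pair_iff_of_encard_eq_two fun _ hC ↦ hC.subset_ground

lemma isSeriesExtension_iff :
    IsSeriesExtension M' M ↔ ∃ a b, a ≠ b ∧ M'.IsCocircuit {a, b} ∧ M' ／ {a} = M :=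
  exists_pair_iff_of_encard_eq_two fun _ hC ↦ hC.subset_ground

lemma dual_isSeriesExtension_iff : IsSeriesExtension M'✶ M✶ ↔ IsParallelExtension M' M := by
  simp only [isSeriesExtension_iff, isParallelExtension_iff, dual_isCocircuit_iff, ← dual_delete,
    dual_inj]

lemma dual_isParallelExtension_iff : IsParallelExtension M'✶ M✶ ↔ IsSeriesExtension M' M := by
  rw [← dual_isSeriesExtension_iff, dual_dual, dual_dual]

lemma isSeriesParallel_dual (h : M.IsSeriesParallel) : M✶.IsSeriesParallel := by
  induction h with
  | loop e => rw [loopyOn_dual_eq]; exact .coloop e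
  | coloop e => rw [freeOn_dual_eq]; exact .loop e
  | parallel _ h ih => exact .series ih (dual_isSeriesExtension_iff.2 h)
  | series _ h ih => exact .parallel ih (dual_isParallelExtension_iff.2 h)

lemma ground_nonempty_of_isSeriesParallel (h : M.IsSeriesParallel) : M.E.Nonempty := by
  cases h with
  | loop e => exact ⟨e, rfl⟩
  | coloop e => exact ⟨e, rfl⟩
  | parallel _ h => exact h.imp fun _ h ↦ h.1
  | series _ h => exact h.imp fun _ h ↦ h.1

lemma finite_of_isSeriesParallel (h : M.IsSeriesParallel) : M.Finite := by
  induction h with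
  | loop e => exact ⟨finite_singleton e⟩
  | coloop e => exact ⟨finite_singleton e⟩
  | parallel _ h ih =>
    obtain ⟨e, -, -, rfl⟩ := h
    exact ⟨ih.ground_finite.of_sdiff (finite_singleton e)⟩
  | series _ h ih =>
    obtain ⟨e, -, -, rfl⟩ := h
    exact ⟨ih.ground_finite.of_sdiff (finite_singleton e)⟩

lemma isConn_of_isParallelExtension [M.Finitary] (h : IsParallelExtension M N) (hN : IsConn N) :
    IsConn M := by
  obtain ⟨a, b, hab, hC, rfl⟩ := isParallelExtension_iff.1 h
  have hb : b ∈ M.E := hC.subset_ground (by simp)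
  refine isConn_of_component_eq (e := b) ((component_subset_ground hb).antisymm fun f hf ↦ ?_)
  obtain rfl | hfa := eq_or_ne f a
  · exact mem_component_of_isCircuit hC (by simp) (by simp)
  obtain rfl | hbf := eq_or_ne b f
  · exact mem_component_self M b
  obtain ⟨C, hC, hbC, hfC⟩ := hN.exists_isCircuit ⟨hb, hab.symm⟩ ⟨hf, hfa⟩ hbf
  exact mem_component_of_isCircuit hC.of_delete hbC hfC

lemma exists_ne_mem_isCircuit_of_isCocircuit {K : Set α} (hK : M.IsCocircuit K)
    (hnt : K.Nontrivial) (he : e ∈ K) : ∃ f ≠ e, ∃ C, M.IsCircuit C ∧ e ∈ C ∧ f ∈ C := by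
  have hcoloop : ¬ M.IsColoop e := (hK.isCircuit.isNonloop_of_mem hnt he).not_isLoop
  obtain ⟨C, hC, heC⟩ := exists_mem_isCircuit_of_not_isColoop (hK.subset_ground he) hcoloop
  obtain ⟨f, ⟨hfC, -⟩, hfe⟩ := (hC.isCocircuit_inter_nontrivial hK ⟨e, heC, he⟩).exists_ne e
  exact ⟨f, hfe, C, hC, heC, hfC⟩

lemma isConn_of_isSeriesExtension [M.Finitary] (h : IsSeriesExtension M N) (hN : IsConn N) :
    IsConn M := by
  obtain ⟨a, b, hab, hK, rfl⟩ := isSeriesExtension_iff.1 h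
  obtain ⟨g, hga, C, hC, haC, hgC⟩ :=
    exists_ne_mem_isCircuit_of_isCocircuit hK (nontrivial_pair hab) (mem_insert a _)
  have hg : g ∈ M.E := hC.subset_ground hgC
  refine isConn_of_component_eq (e := g) ((component_subset_ground hg).antisymm fun f hf ↦ ?_)
  obtain rfl | hfa := eq_or_ne f a
  · exact mem_component_of_isCircuit hC hgC haC
  obtain rfl | hgf := eq_or_ne g f
  · exact mem_component_self M g
  obtain ⟨D, hD, hgD, hfD⟩ := hN.exists_isCircuit ⟨hg, hga⟩ ⟨hf, hfa⟩ hgf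
  obtain ⟨D', hD', hDD', -⟩ := hD.exists_subset_isCircuit_of_contract
  exact mem_component_of_isCircuit hD' (hDD' hgD) (hDD' hfD)

lemma isConn_of_isSeriesParallel (h : M.IsSeriesParallel) : IsConn M := by
  have hfin := finite_of_isSeriesParallel h
  induction h with
  | loop e | coloop e =>
    refine isConn_of_component_eq (e := e) ((component_subset_ground rfl).antisymm ?_)
    exact fun f hf ↦ Or.inl hf
  | parallel hM h ih =>
    exact isConn_of_isParallelExtension h (ih (finite_of_isSeriesParallel hM))
  | series hM h ih => exact isConn_of_isSeriesExtension h (ih (finite_of_isSeriesParallel hM))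

lemma map_isParallelExtension {f : α → β} (h : IsParallelExtension M N) (hf : InjOn f M.E) :
    ∃ hf', IsParallelExtension (M.map f hf) (N.map f hf') := by
  obtain ⟨a, b, hab, hC, rfl⟩ := isParallelExtension_iff.1 h
  have ha : a ∈ M.E := hC.subset_ground (by simp)
  have hb : b ∈ M.E := hC.subset_ground (by simp)
  refine ⟨hf.mono sdiff_subset,
    isParallelExtension_iff.2 ⟨f a, f b, hf.ne ha hb hab, ?_, map_delete hf ha⟩⟩
  rw [← image_pair]
  exact (map_image_isCircuit_iff hf hC.subset_ground).2 hC

lemma isSeriesParallel_map {f : α → β} (h : M.IsSeriesParallel) (hf : InjOn f M.E) :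
    (M.map f hf).IsSeriesParallel := by
  induction h with
  | loop e => rw [map_loopyOn, image_singleton]; exact .loop _
  | coloop e => rw [map_freeOn, image_singleton]; exact .coloop _
  | parallel _ h ih =>
    obtain ⟨hf', h'⟩ := map_isParallelExtension h hf
    exact .parallel (ih hf') h'
  | @series M M' _ h ih =>
    obtain ⟨hf', h'⟩ := map_isParallelExtension (dual_isParallelExtension_iff.2 h) hf
    rw [← map_dual, ← map_dual (M := M) (hf := hf'), dual_isParallelExtension_iff] at h'
    exact .series (ih hf') h'

lemma map_isSeriesParallel_iff {f : α → β} (hf : InjOn f M.E) :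
    (M.map f hf).IsSeriesParallel ↔ M.IsSeriesParallel := by
  refine ⟨fun h ↦ ?_, fun h ↦ isSeriesParallel_map h hf⟩
  have : Nonempty α := (ground_nonempty_of_isSeriesParallel h).of_image.to_subtype.map (↑)
  have hg : InjOn (f.invFunOn M.E) (M.map f hf).E := f.invFunOn_injOn_image M.E
  simpa only [map_map_of_leftInvOn hf hf.leftInvOn_invFunOn hg] using isSeriesParallel_map h hg

end Extensions

section ParallelPairs

variable {M N : Matroid α} {a b e u x : α} {I X : Set α}

lemma isNonloop_of_isCircuit_pair (h : M.IsCircuit {a, b}) (hab : a ≠ b) : M.IsNonloop a :=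
  h.isNonloop_of_mem (nontrivial_pair hab) (mem_insert a _)

lemma closure_eq_of_isCircuit_pair (h : M.IsCircuit {a, b}) (hab : a ≠ b) :
    M.closure {a} = M.closure {b} :=
  ((isNonloop_of_isCircuit_pair h hab).closure_eq_closure_iff_isCircuit_of_ne hab).2 h

lemma isCircuit_pair_trans (h : M.IsCircuit {a, b}) (h' : M.IsCircuit {b, e}) (hab : a ≠ b)
    (hbe : b ≠ e) (hae : a ≠ e) : M.IsCircuit {a, e} :=
  ((isNonloop_of_isCircuit_pair h hab).closure_eq_closure_iff_isCircuit_of_ne hae).1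
    ((closure_eq_of_isCircuit_pair h hab).trans (closure_eq_of_isCircuit_pair h' hbe))

lemma isCircuit_pair_of_dep (h : M.Dep {a, b}) (ha : ¬ M.IsLoop a) (hb : ¬ M.IsLoop b) :
    M.IsCircuit {a, b} := by
  obtain ⟨C, hCss, hC⟩ := h.exists_isCircuit_subset
  rcases subset_pair_iff_eq.1 hCss with rfl | rfl | rfl | rfl
  · exact (hC.nonempty.ne_empty rfl).elim
  · exact (ha (singleton_isCircuit.1 hC)).elim
  · exact (hb (singleton_isCircuit.1 hC)).elim
  · exact hC

lemma mem_closure_iff_of_isCircuit_pair (h : M.IsCircuit {a, b}) (hab : a ≠ b) :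
    a ∈ M.closure X ↔ b ∈ M.closure X := by
  have ha : {a} ⊆ M.E := singleton_subset_iff.2 (h.subset_ground (by simp))
  have hb : {b} ⊆ M.E := singleton_subset_iff.2 (h.subset_ground (by simp))
  rw [← singleton_subset_iff, ← closure_subset_closure_iff_subset_closure,
    closure_eq_of_isCircuit_pair h hab, closure_subset_closure_iff_subset_closure,
    singleton_subset_iff]

lemma insert_indep_iff_of_isCircuit_pair (h : M.IsCircuit {a, b}) (hab : a ≠ b) (ha : a ∉ I)
    (hb : b ∉ I) : M.Indep (insert a I) ↔ M.Indep (insert b I) := by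
  by_cases hI : M.Indep I
  · have haE : a ∈ M.E := h.subset_ground (by simp)
    have hbE : b ∈ M.E := h.subset_ground (by simp)
    simp only [hI.insert_indep_iff_of_notMem ha, hI.insert_indep_iff_of_notMem hb, mem_sdiff,
      haE, hbE, true_and, mem_closure_iff_of_isCircuit_pair h hab]
  · exact iff_of_false (fun h ↦ hI (h.subset (subset_insert a I)))
      (fun h ↦ hI (h.subset (subset_insert b I)))

lemma eq_of_delete_eq_of_isCircuit_pair (hM : M.IsCircuit {x, u}) (hN : N.IsCircuit {x, u})
    (hxu : x ≠ u) (h : M ＼ {x} = N ＼ {x}) : M = N := by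
  have hdel {J : Set α} (hxJ : x ∉ J) : M.Indep J ↔ N.Indep J := by
    simpa [hxJ] using congrArg (Indep · J) h
  have hE : M.E = N.E := by
    rw [← insert_sdiff_self_of_mem (hM.subset_ground (mem_insert x _)), ← delete_ground, h,
      delete_ground, insert_sdiff_self_of_mem (hN.subset_ground (mem_insert x _))]
  refine ext_indep hE fun I _ ↦ ?_
  by_cases hxI : x ∈ I
  · obtain ⟨J, rfl, hxJ⟩ : ∃ J, I = insert x J ∧ x ∉ J := ⟨I \ {x}, by simp [hxI], by simp⟩
    by_cases huJ : u ∈ J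
    · have hss : {x, u} ⊆ insert x J := insert_subset_insert (singleton_subset_iff.2 huJ)
      exact iff_of_false (fun hI ↦ hM.not_indep (hI.subset hss))
        (fun hI ↦ hN.not_indep (hI.subset hss))
    · rw [insert_indep_iff_of_isCircuit_pair hM hxu hxJ huJ,
        insert_indep_iff_of_isCircuit_pair hN hxu hxJ huJ, hdel (by simp [hxu, hxJ])]
  · exact hdel hxI

lemma eRank_delete_of_isCircuit_pair (h : M.IsCircuit {x, u}) : (M ＼ {x}).eRank = M.eRank := by
  have hx : ¬ M.IsColoop x := h.not_isColoop_of_mem (mem_insert x _)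
  rw [isColoop_iff_sdiff_closure, not_not] at hx
  rw [delete_eq_restrict, eRank_restrict, ← eRk_closure_eq, hx, eRk_ground]

lemma indep_image_swap_of_isCircuit_pair [DecidableEq α] (h : M.IsCircuit {a, b}) (hab : a ≠ b)
    (hI : M.Indep I) : M.Indep (Equiv.swap a b '' I) := by
  have hfix {J : Set α} (ha : a ∉ J) (hb : b ∉ J) : Equiv.swap a b '' J = J :=
    EqOn.image_eq_self fun y hy ↦
      Equiv.swap_apply_of_ne_of_ne (ne_of_mem_of_not_mem hy ha) (ne_of_mem_of_not_mem hy hb)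
  wlog hbI : b ∉ I generalizing a b
  · rw [not_not] at hbI
    rw [Equiv.swap_comm]
    refine this (pair_comm a b ▸ h) hab.symm (fun hb ha ↦ Equiv.swap_comm a b ▸ hfix ha hb)
      fun haI ↦ ?_
    exact h.not_indep (hI.subset (pair_subset haI hbI))
  by_cases haI : a ∈ I
  · obtain ⟨J, rfl, haJ⟩ : ∃ J, I = insert a J ∧ a ∉ J := ⟨I \ {a}, by simp [haI], by simp⟩
    have hbJ : b ∉ J := fun hb ↦ hbI (Or.inr hb)
    rw [image_insert_eq, Equiv.swap_apply_left, hfix haJ hbJ]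
    exact (insert_indep_iff_of_isCircuit_pair h hab haJ hbJ).1 hI
  · rwa [hfix haI hbI]

lemma map_swap_of_isCircuit_pair [DecidableEq α] (h : M.IsCircuit {a, b}) (hab : a ≠ b) :
    M.map (Equiv.swap a b) (Equiv.injective _).injOn = M := by
  have haE : a ∈ M.E := h.subset_ground (by simp)
  have hbE : b ∈ M.E := h.subset_ground (by simp)
  have hinv (I : Set α) : Equiv.swap a b '' (Equiv.swap a b '' I) = I := by
    simp [image_image]
  have hE : Equiv.swap a b '' M.E = M.E := by
    have hss : Equiv.swap a b '' M.E ⊆ M.E := image_subset_iff.2 fun y hy ↦ by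
      rw [mem_preimage, Equiv.swap_apply_def]
      split_ifs <;> assumption
    exact hss.antisymm (by simpa only [hinv] using image_mono (f := Equiv.swap a b) hss)
  refine ext_indep hE fun I _ ↦ ⟨?_, fun hI ↦ ?_⟩
  · rintro ⟨J, hJ, rfl⟩
    exact indep_image_swap_of_isCircuit_pair h hab hJ
  · exact ⟨_, indep_image_swap_of_isCircuit_pair h hab hI, (hinv I).symm⟩

lemma delete_eq_map_swap_of_isCircuit_pair [DecidableEq α] (h : M.IsCircuit {a, b})
    (hab : a ≠ b) :
    M ＼ {b} = (M ＼ {a}).map (Equiv.swap a b) (Equiv.injective _).injOn := by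
  rw [← map_delete (Equiv.injective _).injOn (h.subset_ground (mem_insert a _)),
    Equiv.swap_apply_left, map_swap_of_isCircuit_pair h hab]

end ParallelPairs

section ParallelExtension

variable {N : Matroid α} {u x : α} {I : Set α}

open Classical in
/-- The matroid obtained from `N` by adding a new element `x` parallel to `u`,
defined as the pullback of `N` along the map sending `x` to `u` and fixing all other elements. -/
noncomputable def addParallel (N : Matroid α) (x u : α) : Matroid α :=
  N.comap (Function.update id x u)

lemma eqOn_update_id [DecidableEq α] (hx : x ∉ I) : EqOn (Function.update id x u) id I :=
  fun _ hy ↦ Function.update_of_ne (ne_of_mem_of_not_mem hy hx) _ _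

lemma addParallel_ground (hx : x ∉ N.E) (hu : u ∈ N.E) :
    (addParallel N x u).E = insert x N.E := by
  ext y
  obtain rfl | hyx := eq_or_ne y x <;> simp [addParallel, *]

lemma addParallel_delete (hx : x ∉ N.E) (hu : u ∈ N.E) : addParallel N x u ＼ {x} = N := by
  classical
  have hE : (addParallel N x u ＼ {x}).E = N.E := by simp [addParallel_ground hx hu, hx]
  refine ext_indep hE fun I hI ↦ ?_
  have hxI : x ∉ I := fun h ↦ (hI h).2 rfl
  simp [addParallel, hxI, (eqOn_update_id hxI).image_eq, (eqOn_update_id hxI).injOn_iff]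

lemma addParallel_isCircuit (hx : x ∉ N.E) (hu : N.IsNonloop u) :
    (addParallel N x u).IsCircuit {x, u} := by
  have hux : u ≠ x := ne_of_mem_of_not_mem hu.mem_ground hx
  refine isCircuit_pair_of_dep ⟨fun h ↦ ?_, ?_⟩ ?_ ?_
  · exact hux.symm (h.2 (by simp) (by simp) (by simp [hux]))
  · rw [addParallel_ground hx hu.mem_ground]
    exact insert_subset_insert (singleton_subset_iff.2 hu.mem_ground)
  · simpa [addParallel, comap_isLoop_iff] using hu.not_isLoop
  · simpa [addParallel, comap_isLoop_iff, hux] using hu.not_isLoop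

end ParallelExtension

section ParallelDeletion

variable {M : Matroid α} {a b e f u x : α} {C : Set α}

lemma pair_subset_of_isCircuit_of_isCocircuit (hC : M.IsCircuit C) (hK : M.IsCocircuit {e, f})
    (h : (C ∩ {e, f}).Nonempty) : {e, f} ⊆ C := by
  obtain ⟨x, ⟨hxC, hx⟩, y, ⟨hyC, hy⟩, hxy⟩ := hC.isCocircuit_inter_nontrivial hK h
  rcases hx with rfl | rfl <;> rcases hy with rfl | rfl
  exacts [(hxy rfl).elim, pair_subset hxC hyC, pair_subset hyC hxC, (hxy rfl).elim]

lemma not_isLoop_contract_of_isCocircuit_pair (hK : M.IsCocircuit {e, f}) (hef : e ≠ f)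
    (ha : M.IsNonloop a) (haK : a ∉ ({e, f} : Set α)) : ¬ (M ／ {e}).IsLoop a := fun hl ↦ by
  have hcl := ha.closure_eq_of_mem_closure (contract_isLoop_iff_mem_closure.1 hl).1
  have hae : a ≠ e := fun h ↦ haK (Or.inl h)
  have hC := (ha.closure_eq_closure_iff_isCircuit_of_ne hae).1 hcl
  rcases pair_subset_of_isCircuit_of_isCocircuit hC hK ⟨e, by simp⟩ (mem_insert_of_mem e rfl)
    with rfl | h
  · exact haK (Or.inr rfl)
  · exact hef h.symm

lemma isCircuit_pair_contract (hC : M.IsCircuit {a, b}) (hK : M.IsCocircuit {e, f}) (hab : a ≠ b)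
    (hef : e ≠ f) (hdisj : Disjoint ({a, b} : Set α) {e, f}) : (M ／ {e}).IsCircuit {a, b} := by
  refine isCircuit_pair_of_dep (hC.contract_dep (hdisj.symm.mono_left (by simp))) ?_ ?_
  · exact not_isLoop_contract_of_isCocircuit_pair hK hef (isNonloop_of_isCircuit_pair hC hab)
      (disjoint_left.1 hdisj (by simp))
  · exact not_isLoop_contract_of_isCocircuit_pair hK hef
      (isNonloop_of_isCircuit_pair (pair_comm a b ▸ hC) hab.symm) (disjoint_left.1 hdisj (by simp))

lemma delete_eq_freeOn_of_isCircuit_of_isCocircuit (hC : M.IsCircuit {e, f})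
    (hK : M.IsCocircuit {e, f}) (hef : e ≠ f) (hconn : IsConn M) : M ＼ {e} = freeOn {f} := by
  have heE : e ∈ M.E := hC.subset_ground (by simp)
  have hE : M.E = {e, f} := by
    refine Subset.antisymm (fun g hg ↦ ?_) hC.subset_ground
    obtain rfl | heg := eq_or_ne e g
    · exact mem_insert _ _
    obtain ⟨D, hD, heD, hgD⟩ := hconn.exists_isCircuit heE hg heg
    rwa [hC.eq_of_subset_isCircuit hD
      (pair_subset_of_isCircuit_of_isCocircuit hD hK ⟨e, heD, mem_insert e _⟩)]
  rw [delete_eq_restrict, hE, pair_sdiff_left hef]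
  exact (isNonloop_of_isCircuit_pair (pair_comm e f ▸ hC) hef.symm).indep.restrict_eq_freeOn

/-- The property of a matroid that deleting an element having a parallel partner leaves a
series-parallel matroid. -/
def IsParallelDeletable (M : Matroid α) : Prop :=
  ∀ ⦃e f⦄, e ≠ f → M.IsCircuit {e, f} → (M ＼ {e}).IsSeriesParallel

lemma isParallelDeletable_of_parallel (hC : M.IsCircuit {a, b}) (hab : a ≠ b)
    (hSP : (M ＼ {a}).IsSeriesParallel) (h : IsParallelDeletable (M ＼ {a})) :
    IsParallelDeletable M := by
  classical
  intro e f hef hC'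
  obtain rfl | hea := eq_or_ne e a
  · exact hSP
  obtain rfl | heb := eq_or_ne e b
  · rw [delete_eq_map_swap_of_isCircuit_pair hC hab]
    exact isSeriesParallel_map hSP _
  obtain ⟨f', hf'a, hef', hf'⟩ : ∃ f', f' ≠ a ∧ e ≠ f' ∧ M.IsCircuit {e, f'} := by
    obtain rfl | hfa := eq_or_ne f a
    · exact ⟨b, hab.symm, heb, isCircuit_pair_trans hC' hC hef hab heb⟩
    · exact ⟨f, hfa, hef, hC'⟩
  refine .parallel (M := M ＼ {a} ＼ {e}) (h hef' ?_) (isParallelExtension_iff.2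
    ⟨a, b, hab, ?_, delete_comm M _ _⟩)
  · exact delete_isCircuit_iff.2 ⟨hf', by simp [hea.symm, hf'a.symm]⟩
  · exact delete_isCircuit_iff.2 ⟨hC, by simp [hea, heb]⟩

lemma isParallelDeletable_of_series (hK : M.IsCocircuit {a, b}) (hab : a ≠ b) (hconn : IsConn M)
    (h : IsParallelDeletable (M ／ {a})) : IsParallelDeletable M := by
  intro e f hef hC
  by_cases hdisj : Disjoint ({e, f} : Set α) {a, b}
  · have hne : Disjoint ({a} : Set α) {e} := hdisj.symm.mono (by simp) (by simp)
    refine .series (h hef (isCircuit_pair_contract hC hK hef hab hdisj))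
      (isSeriesExtension_iff.2 ⟨a, b, hab, ?_, (contract_delete_comm M hne).symm⟩)
    rw [isCocircuit_def, dual_delete]
    exact isCircuit_pair_contract hK.isCircuit (by simpa using hC) hab hef hdisj.symm
  · have hss := pair_subset_of_isCircuit_of_isCocircuit hC hK
      (not_disjoint_iff_nonempty_inter.1 hdisj)
    have heq : ({a, b} : Set α) = {e, f} := (toFinite _).eq_of_subset_of_encard_le hss
      (by rw [encard_pair hab, encard_pair hef])
    rw [delete_eq_freeOn_of_isCircuit_of_isCocircuit hC (heq ▸ hK) hef hconn]
    exact .coloop f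

lemma isParallelDeletable_of_subsingleton (h : M.E.Subsingleton) : IsParallelDeletable M :=
  fun _ _ hef hC ↦ (hef (h (hC.subset_ground (by simp)) (hC.subset_ground (by simp)))).elim

lemma isParallelDeletable_of_isSeriesParallel (h : M.IsSeriesParallel) :
    IsParallelDeletable M ∧ IsParallelDeletable M✶ := by
  induction h with
  | loop e | coloop e =>
    exact ⟨isParallelDeletable_of_subsingleton subsingleton_singleton,
      isParallelDeletable_of_subsingleton subsingleton_singleton⟩
  | parallel hM h ih =>
    have hconn := isConn_of_isSeriesParallel (isSeriesParallel_dual (hM.parallel h))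
    obtain ⟨a, b, hab, hC, rfl⟩ := isParallelExtension_iff.1 h
    rw [dual_delete] at ih
    exact ⟨isParallelDeletable_of_parallel hC hab hM ih.1,
      isParallelDeletable_of_series (by simpa using hC) hab hconn ih.2⟩
  | series hM h ih =>
    have hconn := isConn_of_isSeriesParallel (hM.series h)
    obtain ⟨a, b, hab, hK, rfl⟩ := isSeriesExtension_iff.1 h
    rw [dual_contract] at ih
    exact ⟨isParallelDeletable_of_series hK hab hconn ih.1, isParallelDeletable_of_parallel
      hK.isCircuit hab (dual_contract _ _ ▸ isSeriesParallel_dual hM) ih.2⟩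

lemma delete_isSeriesParallel_iff (h : M.IsCircuit {x, u}) (hxu : x ≠ u) :
    (M ＼ {x}).IsSeriesParallel ↔ M.IsSeriesParallel :=
  ⟨fun h' ↦ .parallel h' (isParallelExtension_iff.2 ⟨x, u, hxu, h, rfl⟩),
    fun h' ↦ (isParallelDeletable_of_isSeriesParallel h').1 hxu h⟩

end ParallelDeletion

section Labelings

variable {M N : Matroid α} {G : Type*} [Group G]

variable (G) in
/-- The number of equivalence classes of `G`-labelings of `M` (junk value `0` if infinite). -/
noncomputable def labelCount (M : Matroid α) : ℕ :=
  Nat.card (Quotient (labelingSetoid G M))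

open Classical in
/-- Restricting labelings of a disjoint sum to the two summands. -/
noncomputable def labelingEquivProd (h : Disjoint M.E N.E) :
    ((M.disjointSum N h).E → G) ≃ (M.E → G) × (N.E → G) :=
  (Equiv.arrowCongr ((Equiv.setCongr disjointSum_ground_eq).trans (Equiv.Set.union h))
    (Equiv.refl G)).trans (Equiv.sumArrowEquivProdArrow _ _ _)

lemma labelingSetoid_disjointSum_iff (h : Disjoint M.E N.E) (a b : (M.disjointSum N h).E → G) :
    labelingSetoid G (M.disjointSum N h) a b ↔
      (labelingSetoid G M).prod (labelingSetoid G N) (labelingEquivProd h a)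
        (labelingEquivProd h b) := by
  have hsum {K : Set α} := disjointSum_isComponent_iff (K := K) h
  have hM {e : α} (he : e ∈ M.E) : e ∈ (M.disjointSum N h).E :=
    disjointSum_ground_eq ▸ Or.inl he
  have hN {e : α} (he : e ∈ N.E) : e ∈ (M.disjointSum N h).E :=
    disjointSum_ground_eq ▸ Or.inr he
  constructor
  · refine fun hab ↦ ⟨fun K hK ↦ ?_, fun K hK ↦ ?_⟩
    · exact (hab K (hsum.2 (.inl hK))).imp fun g hg e he ↦ hg ⟨e, hM e.2⟩ he
    · exact (hab K (hsum.2 (.inr hK))).imp fun g hg e he ↦ hg ⟨e, hN e.2⟩ he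
  · rintro ⟨h₁, h₂⟩ K hK
    rcases hsum.1 hK with hK | hK
    · exact (h₁ K hK).imp fun g hg e he ↦ hg ⟨e, subset_ground_of_isComponent hK he⟩ he
    · exact (h₂ K hK).imp fun g hg e he ↦ hg ⟨e, subset_ground_of_isComponent hK he⟩ he

lemma labelCount_disjointSum (h : Disjoint M.E N.E) :
    labelCount G (M.disjointSum N h) = labelCount G M * labelCount G N := by
  rw [labelCount, labelCount, labelCount, ← Nat.card_prod]
  exact Nat.card_congr ((Quotient.congr (labelingEquivProd h)
    (labelingSetoid_disjointSum_iff h)).trans (Setoid.prodQuotientEquiv _ _).symm)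

lemma IsConn.labelingSetoid_iff (hM : IsConn M) (hne : M.E.Nonempty) {a b : M.E → G} :
    labelingSetoid G M a b ↔ ∃ g : G, a = g • b := by
  obtain ⟨e, he⟩ := hne
  constructor
  · intro h
    obtain ⟨g, hg⟩ := h M.E ⟨e, he, (hM e he).symm⟩
    exact ⟨g, funext fun f ↦ hg f f.2⟩
  · rintro ⟨g, rfl⟩ K -
    exact ⟨g, fun _ _ ↦ rfl⟩

lemma IsConn.card_mul_labelCount [M.Finite] (hM : IsConn M) (hne : M.E.Nonempty) :
    Nat.card G * labelCount G M = Nat.card G ^ M.E.ncard := by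
  have hne' := hne
  obtain ⟨e, he⟩ := hne
  have : Finite M.E := M.ground_finite
  rw [labelCount, ← Nat.card_coe_set_eq, ← Nat.card_fun, ← Nat.card_prod]
  refine (Nat.card_congr (Equiv.ofBijective
    (fun a : M.E → G ↦ (a ⟨e, he⟩, Quotient.mk (labelingSetoid G M) a)) ⟨?_, ?_⟩)).symm
  · intro a b h
    obtain ⟨hval, hclass⟩ := Prod.mk.inj h
    obtain ⟨g, rfl⟩ := (hM.labelingSetoid_iff hne').1 (Quotient.exact hclass)
    have hg : g = 1 := by simpa using hval
    rw [hg, one_smul]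
  · rintro ⟨g, x⟩
    induction x using Quotient.inductionOn with | _ a
    refine ⟨(g * (a ⟨e, he⟩)⁻¹) • a, Prod.ext ?_ (Quotient.sound ?_)⟩
    · simp
    · exact (hM.labelingSetoid_iff hne').2 ⟨_, rfl⟩

lemma labelCount_emptyOn : labelCount G (emptyOn α) = 1 := by
  have : IsEmpty (emptyOn α).E := isEmpty_coe_sort.2 rfl
  have : Subsingleton (Quotient (labelingSetoid G (emptyOn α))) := Quot.Subsingleton
  rw [labelCount, Nat.card_eq_one_iff_unique]
  exact ⟨this, ⟨⟦isEmptyElim⟧⟩⟩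

end Labelings

section MatroidsOn

variable {M : Matroid α} {E : Finset α}

lemma finite_setOf_ground_eq (E : Finset α) : {M : Matroid α | M.E = E}.Finite := by
  refine Set.Finite.of_injOn (f := fun M ↦ {I | M.Indep I}) (t := 𝒫 (𝒫 ↑E)) ?_ ?_
    E.finite_toSet.powerset.powerset
  · rintro M (hM : M.E = E) I (hI : M.Indep I)
    exact hI.subset_ground.trans hM.subset
  · rintro M (hM : M.E = E) N (hN : N.E = E) h
    exact ext_indep (hM.trans hN.symm) fun I _ ↦ Set.ext_iff.1 h I

/-- The finset of all matroids with ground set `E`. -/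
noncomputable def matroidsOn (E : Finset α) : Finset (Matroid α) :=
  (finite_setOf_ground_eq E).toFinset

@[simp] lemma mem_matroidsOn : M ∈ matroidsOn E ↔ M.E = E := by
  simp [matroidsOn]

lemma finite_of_mem_matroidsOn (hM : M ∈ matroidsOn E) : M.Finite :=
  ⟨by rw [mem_matroidsOn.1 hM]; exact E.finite_toSet⟩

lemma matroidsOn_empty : matroidsOn (∅ : Finset α) = {emptyOn α} := by
  ext M
  simp [← ground_eq_empty_iff]

lemma map_mem_matroidsOn_map {β : Type*} {M : Matroid β} {E : Finset β} (f : β ↪ α) :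
    M.map f f.injective.injOn ∈ matroidsOn (E.map f) ↔ M ∈ matroidsOn E := by
  simp [f.injective.image_injective.eq_iff]

lemma sum_matroidsOn_map {β R : Type*} [AddCommMonoid R] (w : Matroid α → R) (f : β ↪ α)
    (E : Finset β) :
    ∑ M ∈ matroidsOn (E.map f), w M = ∑ M ∈ matroidsOn E, w (M.map f f.injective.injOn) := by
  have hmap {M : Matroid α} (hM : M ∈ matroidsOn (E.map f)) :
      (M.comap f).map f f.injective.injOn = M := by
    rw [mem_matroidsOn, Finset.coe_map] at hM
    exact map_comap (hM ▸ image_subset_range f E) f.injective.injOn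
  refine Finset.sum_nbij' (·.comap f) (·.map f f.injective.injOn) (fun M hM ↦ ?_)
    (fun M hM ↦ (map_mem_matroidsOn_map f).2 hM) (fun M hM ↦ hmap hM)
    (fun M _ ↦ comap_map f.injective) (fun M hM ↦ by rw [hmap hM])
  rwa [← map_mem_matroidsOn_map f, hmap hM]

lemma sum_matroidsOn_eq_sum_matroidsOn_univ {R : Type*} [AddCommMonoid R] (w : Matroid α → R)
    (E : Finset α) (w' : Matroid (Fin E.card) → R)
    (hw : ∀ (f : Fin E.card ↪ α) M, w (M.map f f.injective.injOn) = w' M) :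
    ∑ M ∈ matroidsOn E, w M = ∑ M ∈ matroidsOn Finset.univ, w' M := by
  let f : Fin E.card ↪ α := E.equivFin.symm.toEmbedding.trans (.subtype _)
  have hf : Finset.univ.map f = E := by
    rw [← Finset.map_map, Finset.map_univ_equiv, Finset.univ_eq_attach, Finset.attach_map_val]
  rw [← Finset.sum_congr rfl fun M _ ↦ hw f M, ← sum_matroidsOn_map, hf]

end MatroidsOn

section ExponentialFormula

variable {E K L : Finset α} {e : α} {R : Type*} [CommRing R] {w : Matroid α → R}

open Classical in
lemma sum_filter_component_eq
    (hw : ∀ (M N : Matroid α) [M.Finite] [N.Finite] (h : Disjoint M.E N.E),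
      w (M.disjointSum N h) = w M * w N)
    (hKL : Disjoint K L) (he : e ∈ K) :
    ∑ M ∈ matroidsOn (K ∪ L) with M.component e = ↑K, w M =
      (∑ M ∈ matroidsOn K with IsConn M, w M) * ∑ M ∈ matroidsOn L, w M := by
  rw [Finset.sum_mul_sum, ← Finset.sum_product']
  have hd : Disjoint (K : Set α) L := Finset.disjoint_coe.2 hKL
  have hmem {p : Matroid α × Matroid α} :
      p ∈ ({M ∈ matroidsOn K | IsConn M} ×ˢ matroidsOn L) ↔
        (p.1.E = K ∧ IsConn p.1) ∧ p.2.E = L := by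
    simp only [Finset.mem_product, Finset.mem_filter, mem_matroidsOn]
  have hdisj {p : Matroid α × Matroid α}
      (hp : p ∈ ({M ∈ matroidsOn K | IsConn M} ×ˢ matroidsOn L)) : Disjoint p.1.E p.2.E := by
    rwa [(hmem.1 hp).1.1, (hmem.1 hp).2]
  have hmem' {M : Matroid α} (hM : M ∈ {M ∈ matroidsOn (K ∪ L) | M.component e = ↑K}) :
      M.Finite ∧ M.E = ↑(K ∪ L) ∧ e ∈ M.E ∧ M.component e = ↑K := by
    obtain ⟨hME, hK⟩ := Finset.mem_filter.1 hM
    have hE := mem_matroidsOn.1 hME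
    exact ⟨finite_of_mem_matroidsOn hME, hE, by simp [hE, he], hK⟩
  have hsum {M : Matroid α} (hM : M ∈ {M ∈ matroidsOn (K ∪ L) | M.component e = ↑K}) :
      (M ↾ (K : Set α)).disjointSum (M ↾ (L : Set α)) hd = M := by
    obtain ⟨hfin, hE, -, hK⟩ := hmem' hM
    exact disjointSum_restrict_of_component_eq hd (hE.trans (Finset.coe_union K L)) hK
  refine Finset.sum_bij' (i := fun M _ ↦ (M ↾ (K : Set α), M ↾ (L : Set α)))
    (j := fun p hp ↦ p.1.disjointSum p.2 (hdisj hp)) (fun M hM ↦ ?_) (fun p hp ↦ ?_)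
    (fun M hM ↦ hsum hM) (fun p hp ↦ ?_) (fun M hM ↦ ?_)
  · obtain ⟨hfin, -, heM, hK⟩ := hmem' hM
    exact hmem.2 ⟨⟨rfl, hK ▸ isConn_restrict_component heM⟩, rfl⟩
  · obtain ⟨⟨hK, hconn⟩, hL⟩ := hmem.1 hp
    have hep : e ∈ p.1.E := by rw [hK]; exact he
    rw [Finset.mem_filter, mem_matroidsOn, disjointSum_ground_eq,
      disjointSum_component_left _ hep, hconn e hep, hK, hL, Finset.coe_union]
    exact ⟨rfl, rfl⟩
  · obtain ⟨⟨hK, -⟩, hL⟩ := hmem.1 hp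
    rw [← hK, ← hL, disjointSum_restrict_left _ Subset.rfl, disjointSum_restrict_right _ Subset.rfl,
      restrict_ground_eq_self, restrict_ground_eq_self]
  · have : (M ↾ (K : Set α)).Finite := ⟨K.finite_toSet⟩
    have : (M ↾ (L : Set α)).Finite := ⟨L.finite_toSet⟩
    rw [← hw _ _ hd, hsum hM]

open Classical in
lemma sum_matroidsOn_insert
    (hw : ∀ (M N : Matroid α) [M.Finite] [N.Finite] (h : Disjoint M.E N.E),
      w (M.disjointSum N h) = w M * w N)
    (he : e ∉ E) :
    ∑ M ∈ matroidsOn (insert e E), w M =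
      ∑ T ∈ E.powerset, (∑ M ∈ matroidsOn (insert e T) with IsConn M, w M) *
        ∑ M ∈ matroidsOn (E \ T), w M := by
  rw [← Finset.sum_fiberwise_of_maps_to (t := E.powerset)
    (g := fun M ↦ {f ∈ E | f ∈ M.component e}) fun M _ ↦ Finset.mem_powerset.2 (by simp)]
  refine Finset.sum_congr rfl fun T hT ↦ ?_
  rw [Finset.mem_powerset] at hT
  rw [← sum_filter_component_eq hw _ (Finset.mem_insert_self e T), Finset.insert_union,
    Finset.union_sdiff_of_subset hT]
  · refine Finset.sum_congr (Finset.filter_congr fun M hM ↦ ?_) fun _ _ ↦ rfl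
    have hE := mem_matroidsOn.1 hM
    have heM : e ∈ M.E := by simp [hE]
    have hcomp : M.component e = ↑(insert e {f ∈ E | f ∈ M.component e}) := by
      ext f
      have hf : f ∈ M.component e → f = e ∨ f ∈ E := by
        simpa [hE] using fun h ↦ component_subset_ground heM h
      have := mem_component_self M e
      grind
    refine ⟨fun h ↦ h ▸ hcomp, fun h ↦ ?_⟩
    rw [hcomp, Finset.coe_inj] at h
    ext f
    have := Finset.ext_iff.1 h f
    have := @hT f
    grind
  · exact Finset.disjoint_insert_left.2 ⟨by simp [he], Finset.disjoint_sdiff⟩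

open Classical in
lemma sum_matroidsOn_eq_factorial_mul_coeff_exp_subst [Algebra ℚ R]
    (hw : ∀ (M N : Matroid α) [M.Finite] [N.Finite] (h : Disjoint M.E N.E),
      w (M.disjointSum N h) = w M * w N)
    (hw₀ : w (emptyOn α) = 1) {F : R⟦X⟧} (hF₀ : PowerSeries.constantCoeff F = 0)
    (hF : ∀ K : Finset α, K.Nonempty →
      ∑ M ∈ matroidsOn K with IsConn M, w M = (K.card ! : R) * PowerSeries.coeff K.card F)
    (E : Finset α) :
    ∑ M ∈ matroidsOn E, w M =
      (E.card ! : R) * PowerSeries.coeff E.card ((PowerSeries.exp R).subst F) := by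
  induction E using Finset.strongInduction with
  | _ E ih =>
  rcases E.eq_empty_or_nonempty with rfl | ⟨e, he⟩
  · simp [matroidsOn_empty, hw₀, constantCoeff_exp_subst hF₀]
  obtain ⟨E, heE, rfl⟩ : ∃ E', e ∉ E' ∧ insert e E' = E :=
    ⟨E.erase e, Finset.notMem_erase e E, Finset.insert_erase he⟩
  rw [sum_matroidsOn_insert hw heE, Finset.card_insert_of_notMem heE,
    factorial_mul_coeff_succ_exp_subst hF₀, ← Finset.sum_powerset_apply_card (fun k ↦
      (((k + 1) ! : R) * PowerSeries.coeff (k + 1) F) * (((E.card - k) ! : R) *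
        PowerSeries.coeff (E.card - k) ((PowerSeries.exp R).subst F)))]
  refine Finset.sum_congr rfl fun T hT ↦ ?_
  rw [Finset.mem_powerset] at hT
  rw [hF _ (Finset.insert_nonempty e T), Finset.card_insert_of_notMem (mt (@hT e) heE),
    ih (E \ T) (Finset.sdiff_subset.trans_ssubset (Finset.ssubset_insert heE)),
    Finset.card_sdiff_of_subset hT]

end ExponentialFormula

section Counting

variable {M N : Matroid α} {n : ℕ}

/-- The monomial `y ^ r(M)` (equal to `1` if `M` has infinite rank). -/
noncomputable def rankMonomial (M : Matroid α) : ℚ[X] := Polynomial.X ^ M.eRank.toNat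

lemma rankMonomial_disjointSum [M.Finite] [N.Finite] (h : Disjoint M.E N.E) :
    rankMonomial (M.disjointSum N h) = rankMonomial M * rankMonomial N := by
  rw [rankMonomial, eRank_disjointSum, ENat.toNat_add ((eRank_ne_top_iff M).2 inferInstance)
    ((eRank_ne_top_iff N).2 inferInstance), pow_add]
  rfl

lemma rankMonomial_emptyOn : rankMonomial (emptyOn α) = 1 := by
  simp [rankMonomial]

open Classical in
lemma factorial_mul_coeff_bivariateEGF {a : ℕ → ℕ → ℕ} (P : Matroid (Fin n) → Prop)
    [DecidablePred P] (ℓ : Matroid (Fin n) → ℕ)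
    (h : ∀ k : ℕ, a n k = ∑ M ∈ matroidsOn Finset.univ with P M ∧ M.eRank = k, ℓ M) :
    (n ! : ℚ[X]) * PowerSeries.coeff n (bivariateEGF a) =
      ∑ M ∈ matroidsOn Finset.univ with P M, ℓ M * rankMonomial M := by
  have hrank (M : Matroid (Fin n)) : M.eRank ≤ n := by
    refine M.eRank_le_encard_ground.trans ((encard_le_encard (subset_univ _)).trans ?_)
    simp
  rw [bivariateEGF, PowerSeries.coeff_mk, Finset.mul_sum,
    ← Finset.sum_fiberwise_of_maps_to (t := Finset.range (n + 1)) (g := fun M ↦ M.eRank.toNat)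
      fun M _ ↦ Finset.mem_range_succ_iff.2 (ENat.toNat_le_of_le_natCast (hrank M))]
  refine Finset.sum_congr rfl fun k _ ↦ ?_
  have hn : (n ! : ℚ) ≠ 0 := Nat.cast_ne_zero.2 n.factorial_ne_zero
  rw [← Polynomial.C_eq_natCast, Polynomial.C_mul_monomial, mul_div_cancel₀ _ hn,
    ← Polynomial.C_mul_X_pow_eq_monomial, h, map_natCast, Nat.cast_sum, Finset.sum_mul,
    Finset.filter_filter]
  refine Finset.sum_congr (Finset.filter_congr fun M _ ↦ and_congr_right fun _ ↦ ?_)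
    fun M hM ↦ ?_
  · rw [← ENat.natCast_toNat ((eRank_ne_top_iff M).2 inferInstance), ENat.toNat_natCast,
      Nat.cast_inj]
  · rw [rankMonomial, (Finset.mem_filter.1 hM).2.2]

open Classical in
lemma factorial_mul_coeff_bivariateEGF_of_eq_card {a : ℕ → ℕ → ℕ} (P : Matroid (Fin n) → Prop)
    [DecidablePred P]
    (h : ∀ k : ℕ, a n k = Nat.card {M : Matroid (Fin n) // M.E = univ ∧ P M ∧ M.eRank = k}) :
    (n ! : ℚ[X]) * PowerSeries.coeff n (bivariateEGF a) =
      ∑ M ∈ matroidsOn Finset.univ with P M, rankMonomial M := by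
  rw [factorial_mul_coeff_bivariateEGF P 1 fun k ↦ ?_]
  · simp
  · rw [h, Nat.subtype_card {M ∈ matroidsOn Finset.univ | P M ∧ M.eRank = k} (by simp)]
    simp

lemma sum_filter_matroidsOn_eq_sum_filter_matroidsOn_univ (P : Matroid α → Prop)
    [DecidablePred P] (E : Finset α) (P' : Matroid (Fin E.card) → Prop) [DecidablePred P']
    (hP : ∀ (f : Fin E.card ↪ α) M, P (M.map f f.injective.injOn) ↔ P' M) :
    ∑ M ∈ matroidsOn E with P M, rankMonomial M =
      ∑ M ∈ matroidsOn Finset.univ with P' M, rankMonomial M := by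
  rw [Finset.sum_filter, Finset.sum_filter]
  refine sum_matroidsOn_eq_sum_matroidsOn_univ _ E _ fun f M ↦ ?_
  simp only [hP, rankMonomial, eRank_map]

/-- The set of simple series-parallel matroids on `[n]` of rank `k`. -/
def SimpleSP (n k : ℕ) : Type :=
  {M : Matroid (Fin n) // M.E = univ ∧ (M.IsSeriesParallel ∧ M.IsSimple) ∧ M.eRank = k}

/-- The generating function `B(x,y)` counting simple series-parallel matroids. -/
noncomputable def genSimpleSP : ℚ[X]⟦X⟧ :=
  bivariateEGF fun n k ↦ Nat.card (SimpleSP n k)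

open Classical in
lemma sum_isSeriesParallel (E : Finset α) :
    ∑ M ∈ matroidsOn E with M.IsSeriesParallel, rankMonomial M =
      (E.card ! : ℚ[X]) * PowerSeries.coeff E.card genC := by
  rw [sum_filter_matroidsOn_eq_sum_filter_matroidsOn_univ _ E IsSeriesParallel fun f M ↦
    map_isSeriesParallel_iff f.injective.injOn]
  exact (factorial_mul_coeff_bivariateEGF_of_eq_card _ fun _ ↦ rfl).symm

open Classical in
lemma sum_isSeriesParallel_and_isSimple (E : Finset α) :
    ∑ M ∈ matroidsOn E with M.IsSeriesParallel ∧ M.IsSimple, rankMonomial M =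
      (E.card ! : ℚ[X]) * PowerSeries.coeff E.card genSimpleSP := by
  rw [sum_filter_matroidsOn_eq_sum_filter_matroidsOn_univ
    (fun M ↦ M.IsSeriesParallel ∧ M.IsSimple) E (fun M ↦ M.IsSeriesParallel ∧ M.IsSimple)
    fun f M ↦ and_congr (map_isSeriesParallel_iff f.injective.injOn)
      (map_isSimple_iff f.injective.injOn)]
  exact (factorial_mul_coeff_bivariateEGF_of_eq_card _ fun _ ↦ rfl).symm

lemma not_isSeriesParallel_emptyOn : ¬ (emptyOn α).IsSeriesParallel :=
  fun h ↦ not_nonempty_empty (ground_nonempty_of_isSeriesParallel h)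

lemma constantCoeff_genC : PowerSeries.constantCoeff genC = 0 := by
  simpa [matroidsOn_empty, Finset.filter_singleton, not_isSeriesParallel_emptyOn]
    using (sum_isSeriesParallel (∅ : Finset ℕ)).symm

lemma constantCoeff_genSimpleSP : PowerSeries.constantCoeff genSimpleSP = 0 := by
  simpa [matroidsOn_empty, Finset.filter_singleton, not_isSeriesParallel_emptyOn]
    using (sum_isSeriesParallel_and_isSimple (∅ : Finset ℕ)).symm

end Counting

section LabeledCounting

variable {n k : ℕ} (G : Type*) [Group G]

open Classical in
lemma card_labeledSimpleQSP [Finite G] : Nat.card (LabeledSimpleQSP G n k) =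
    ∑ M ∈ matroidsOn (Finset.univ : Finset (Fin n)) with
      (M.IsQuasiSeriesParallel ∧ M.IsSimple) ∧ M.eRank = (k : ℕ∞),
        labelCount G M := by
  have : Finite (SimpleQSP n k) := .of_injective
    (fun M ↦ (⟨M.1, by simp [M.2.1]⟩ : matroidsOn (Finset.univ : Finset (Fin n))))
    fun M N h ↦ Subtype.ext (congrArg (fun M ↦ M.1) h)
  have := Fintype.ofFinite (SimpleQSP n k)
  have (M : SimpleQSP n k) : Finite (Quotient (labelingSetoid G M.1)) := Quotient.finite _
  rw [LabeledSimpleQSP, Nat.card_sigma]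
  exact (Finset.sum_subtype _ (by simp [and_assoc]) (labelCount G)).symm

lemma genSG_unit : genSG Unit = genS := by
  refine congrArg bivariateEGF (funext₂ fun n k ↦ Nat.card_congr ?_)
  have (M : SimpleQSP n k) : Unique (Quotient (labelingSetoid Unit M.1)) :=
    ⟨⟨⟦1⟧⟩, fun _ ↦ Subsingleton.elim _ _⟩
  exact Equiv.sigmaUnique _ _

open Classical in
lemma sum_isConn_labelCount [Finite G] {K : Finset α} (hK : K.Nonempty) :
    ∑ M ∈ matroidsOn K with IsConn M,
      (if M.IsQuasiSeriesParallel ∧ M.IsSimple then labelCount G M * rankMonomial M else 0) =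
      (K.card ! : ℚ[X]) * PowerSeries.coeff K.card
        ((1 / Nat.card G : ℚ) • PowerSeries.rescale (Nat.card G : ℚ[X]) genSimpleSP) := by
  have hq : (Nat.card G : ℚ) ≠ 0 := Nat.cast_ne_zero.2 Nat.card_pos.ne'
  have hcount {M : Matroid α} (hM : M ∈ matroidsOn K) (hsp : M.IsSeriesParallel) :
      (labelCount G M : ℚ[X]) = (1 / Nat.card G : ℚ) • (Nat.card G : ℚ[X]) ^ K.card := by
    have := finite_of_mem_matroidsOn hM
    have h := (isConn_of_isSeriesParallel hsp).card_mul_labelCount (G := G)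
      (ground_nonempty_of_isSeriesParallel hsp)
    rw [mem_matroidsOn.1 hM, ncard_coe_finset] at h
    rw [← Nat.cast_pow, ← h, Nat.cast_mul, ← nsmul_eq_mul, ← Nat.cast_smul_eq_nsmul ℚ, smul_smul,
      one_div_mul_cancel hq, one_smul]
  rw [LinearMap.map_smul_of_tower, PowerSeries.coeff_rescale, mul_smul_comm, mul_left_comm,
    ← sum_isSeriesParallel_and_isSimple, Finset.mul_sum, Finset.smul_sum, Finset.sum_filter,
    Finset.sum_filter]
  refine Finset.sum_congr rfl fun M hM ↦ ?_
  have hne : M.E.Nonempty := by rw [mem_matroidsOn.1 hM]; exact hK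
  have hiff : IsConn M ∧ M.IsQuasiSeriesParallel ∧ M.IsSimple ↔
      M.IsSeriesParallel ∧ M.IsSimple :=
    ⟨fun ⟨hM, hQ, hS⟩ ↦ ⟨(hM.isQuasiSeriesParallel_iff hne).1 hQ, hS⟩, fun ⟨hM, hS⟩ ↦
      ⟨isConn_of_isSeriesParallel hM,
        ((isConn_of_isSeriesParallel hM).isQuasiSeriesParallel_iff hne).2 hM, hS⟩⟩
  rw [← ite_and, ← smul_mul_assoc]
  simp only [hiff]
  split_ifs with h
  · rw [hcount hM h.1]
  · rfl

lemma isQuasiSeriesParallel_emptyOn : (emptyOn α).IsQuasiSeriesParallel :=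
  fun _ ⟨_, he, _⟩ ↦ he.elim

lemma isSimple_emptyOn : (emptyOn α).IsSimple :=
  fun _ hC ↦ (hC.nonempty.ne_empty (subset_empty_iff.1 hC.subset_ground)).elim

open Classical in
lemma sum_labelCount [Finite G] (E : Finset α) :
    ∑ M ∈ matroidsOn E with M.IsQuasiSeriesParallel ∧ M.IsSimple,
      labelCount G M * rankMonomial M =
      (E.card ! : ℚ[X]) * PowerSeries.coeff E.card ((PowerSeries.exp ℚ[X]).subst
        ((1 / Nat.card G : ℚ) • PowerSeries.rescale (Nat.card G : ℚ[X]) genSimpleSP)) := by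
  rw [Finset.sum_filter]
  refine sum_matroidsOn_eq_factorial_mul_coeff_exp_subst (fun M N _ _ h ↦ ?_) ?_ ?_
    (fun K hK ↦ sum_isConn_labelCount G hK) E
  · rw [labelCount_disjointSum, rankMonomial_disjointSum, disjointSum_isQuasiSeriesParallel_iff,
      disjointSum_isSimple_iff, ite_zero_mul_ite_zero, Nat.cast_mul, mul_mul_mul_comm]
    exact ite_congr (propext and_and_and_comm) (fun _ ↦ rfl) fun _ ↦ rfl
  · rw [if_pos ⟨isQuasiSeriesParallel_emptyOn, isSimple_emptyOn⟩, labelCount_emptyOn,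
      rankMonomial_emptyOn, Nat.cast_one, mul_one]
  · rw [← PowerSeries.coeff_zero_eq_constantCoeff_apply, LinearMap.map_smul_of_tower,
      PowerSeries.coeff_zero_eq_constantCoeff_apply, constantCoeff_rescale,
      constantCoeff_genSimpleSP, smul_zero]

lemma genSG_eq [Finite G] : genSG G = (PowerSeries.exp ℚ[X]).subst
    ((1 / Nat.card G : ℚ) • PowerSeries.rescale (Nat.card G : ℚ[X]) genSimpleSP) := by
  classical
  ext1 n
  refine mul_left_cancel₀ (Nat.cast_ne_zero.2 n.factorial_ne_zero) ?_
  rw [genSG, factorial_mul_coeff_bivariateEGF _ _ fun k ↦ card_labeledSimpleQSP G]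
  simpa only [Finset.card_fin] using sum_labelCount G (Finset.univ : Finset (Fin n))

lemma genS_eq : genS = (PowerSeries.exp ℚ[X]).subst genSimpleSP := by
  rw [← genSG_unit, genSG_eq]
  simp

end LabeledCounting

section Simplification

variable {M : Matroid α} {x u : α}

lemma restrict_isSimple_iff {U : Set α} (hU : U ⊆ M.E) :
    (M ↾ U).IsSimple ↔ ∀ a ∈ U, ∀ b ∈ U, ¬ M.IsCircuit {a, b} := by
  simp only [IsSimple, restrict_isCircuit_iff hU, and_imp]
  refine ⟨fun h a ha b hb hC ↦ ?_, fun h C hC hCU ↦ ?_⟩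
  · have hle : ({a, b} : Set α).encard ≤ 2 := by
      simpa [one_add_one_eq_two] using encard_insert_le {b} a
    exact hle.not_gt (h _ hC (pair_subset ha hb))
  · by_contra! hle
    obtain ⟨a, ha⟩ := hC.nonempty
    rw [← encard_sdiff_singleton_add_one ha, ← one_add_one_eq_two,
      ENat.add_le_add_iff_right ENat.one_ne_top] at hle
    rcases encard_le_one_iff_eq.1 hle with h₀ | ⟨b, hb⟩
    · have hCa : C = {a, a} := by rw [← insert_sdiff_self_of_mem ha, h₀]; simp
      exact h a (hCU ha) a (hCU ha) (hCa ▸ hC)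
    · have hCab : C = {a, b} := by rw [← insert_sdiff_self_of_mem ha, hb]
      exact h a (hCU ha) b (hCU (hCab ▸ by simp)) (hCab ▸ hC)

lemma isNonloop_of_restrict_isSimple {U : Set α} (hU : U ⊆ M.E) (h : (M ↾ U).IsSimple)
    (hu : u ∈ U) : M.IsNonloop u :=
  (not_isLoop_iff (hU hu)).1 fun hl ↦
    (restrict_isSimple_iff hU).1 h u hu u hu (by simpa [singleton_isCircuit] using hl)

lemma restrict_insert_isSimple_iff {U : Set α} (hU : U ⊆ M.E) (hx : M.IsNonloop x) :
    (M ↾ insert x U).IsSimple ↔ (M ↾ U).IsSimple ∧ ∀ u ∈ U, ¬ M.IsCircuit {x, u} := by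
  have hxx : ¬ M.IsCircuit {x, x} := by simpa [singleton_isCircuit] using hx.not_isLoop
  rw [restrict_isSimple_iff hU, restrict_isSimple_iff (insert_subset hx.mem_ground hU)]
  simp only [forall_mem_insert, hxx, not_false_eq_true, true_and]
  exact ⟨fun h ↦ ⟨fun a ha ↦ (h.2 a ha).2, h.1⟩,
    fun h ↦ ⟨h.2, fun a ha ↦ ⟨pair_comm x a ▸ h.2 a ha, h.1 a ha⟩⟩⟩

lemma delete_restrict_of_notMem {U : Set α} (hU : U ⊆ M.E) (hx : x ∉ U) :
    (M ＼ {x}) ↾ U = M ↾ U := by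
  rw [delete_eq_restrict, restrict_restrict_eq]
  exact subset_sdiff_singleton hU hx

open Classical in
/-- The series-parallel matroids on `E` whose restriction to `U` is simple, counted by rank. It
interpolates between the simple ones (`U = E`) and, up to the single loop, all of them
(`U = {e}`). -/
noncomputable def partialSimpleSum (U E : Finset α) : ℚ[X] :=
  ∑ M ∈ matroidsOn E with M.IsSeriesParallel ∧ (M ↾ (U : Set α)).IsSimple, rankMonomial M

open Classical in
lemma sum_isCircuit_pair {U E : Finset α} (hUE : U ⊆ E) (hx : x ∉ E) (hu : u ∈ U) :
    ∑ M ∈ matroidsOn (insert x E) with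
      (M.IsSeriesParallel ∧ (M ↾ (U : Set α)).IsSimple) ∧ M.IsCircuit {x, u}, rankMonomial M =
      partialSimpleSum U E := by
  have hxU : x ∉ (U : Set α) := fun h ↦ hx (hUE h)
  have hxu : x ≠ u := fun h ↦ hxU (h ▸ hu)
  have hUE' : (U : Set α) ⊆ ↑(insert x E) :=
    Finset.coe_subset.2 (hUE.trans (Finset.subset_insert x E))
  have hN {N : Matroid α} (hN : N.E = E)
      (hS : (N ↾ (U : Set α)).IsSimple) : x ∉ N.E ∧ N.IsNonloop u :=
    ⟨by simpa [hN] using hx,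
      isNonloop_of_restrict_isSimple (hN ▸ Finset.coe_subset.2 hUE) hS hu⟩
  refine Finset.sum_nbij' (· ＼ {x}) (addParallel · x u) ?_ ?_ ?_ ?_ ?_ <;>
    simp only [Finset.mem_filter, mem_matroidsOn, and_imp]
  · intro M hE hSP hS hC
    rw [delete_isSeriesParallel_iff hC hxu, delete_restrict_of_notMem (hE ▸ hUE') hxU]
    exact ⟨by simp [hE, hx], hSP, hS⟩
  · intro N hE hSP hS
    obtain ⟨hxN, huN⟩ := hN hE hS
    have hC := addParallel_isCircuit hxN huN
    have hg := addParallel_ground hxN huN.mem_ground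
    have hg' : (addParallel N x u).E = ↑(insert x E) := by rw [hg, hE, Finset.coe_insert]
    rw [← delete_isSeriesParallel_iff hC hxu, ← delete_restrict_of_notMem (hg' ▸ hUE') hxU,
      addParallel_delete hxN huN.mem_ground]
    exact ⟨hg', ⟨hSP, hS⟩, hC⟩
  · intro M hE _ hS hC
    have hg : (M ＼ {x}).E = E := by simp [hE, hx]
    obtain ⟨hxN, huN⟩ := hN hg (by rwa [delete_restrict_of_notMem (hE ▸ hUE') hxU])
    exact eq_of_delete_eq_of_isCircuit_pair (addParallel_isCircuit hxN huN) hC hxu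
      (addParallel_delete hxN huN.mem_ground)
  · intro N hE _ hS
    obtain ⟨hxN, huN⟩ := hN hE hS
    exact addParallel_delete hxN huN.mem_ground
  · intro M _ _ _ hC
    rw [rankMonomial, rankMonomial, eRank_delete_of_isCircuit_pair hC]

open Classical in
lemma partialSimpleSum_insert {U E : Finset α} (hU : U.Nonempty) (hUE : U ⊆ E) (hx : x ∉ E) :
    partialSimpleSum U (insert x E) =
      U.card * partialSimpleSum U E + partialSimpleSum (insert x U) (insert x E) := by
  have hUE' : (U : Set α) ⊆ ↑(insert x E) :=
    Finset.coe_subset.2 (hUE.trans (Finset.subset_insert x E))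
  have hne {u} (hu : u ∈ U) : x ≠ u := fun h ↦ hx (hUE (h ▸ hu))
  obtain ⟨v, hv⟩ := hU
  have hiff {M : Matroid α} (hM : M ∈ matroidsOn (insert x E)) (hSP : M.IsSeriesParallel) :
      (M ↾ (↑(insert x U) : Set α)).IsSimple ↔
        (M ↾ (U : Set α)).IsSimple ∧ ∀ u ∈ U, ¬ M.IsCircuit {x, u} := by
    rw [mem_matroidsOn] at hM
    have hnt : M.E.Nontrivial := ⟨x, by simp [hM], v, hM ▸ hUE' hv, hne hv⟩
    rw [Finset.coe_insert, restrict_insert_isSimple_iff (hM ▸ hUE')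
      ((isConn_of_isSeriesParallel hSP).isNonloop hnt (by simp [hM]))]
    rfl
  have hpair : ∑ M ∈ matroidsOn (insert x E) with (M.IsSeriesParallel ∧
      (M ↾ (U : Set α)).IsSimple) ∧ ¬ (M ↾ (↑(insert x U) : Set α)).IsSimple, rankMonomial M =
      U.card * partialSimpleSum U E := by
    rw [← nsmul_eq_mul, ← Finset.sum_const,
      ← Finset.sum_congr rfl fun u hu ↦ sum_isCircuit_pair hUE hx hu, ← Finset.sum_biUnion]
    · refine Finset.sum_congr (Finset.ext fun M ↦ ?_) fun _ _ ↦ rfl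
      simp only [Finset.mem_biUnion, Finset.mem_filter]
      grind
    · refine fun u hu w hw huw ↦ Finset.disjoint_left.2 fun M hM hM' ↦ ?_
      simp only [Finset.mem_filter, mem_matroidsOn] at hM hM'
      exact (restrict_isSimple_iff (hM.1 ▸ hUE')).1 hM.2.1.2 u hu w hw
        (isCircuit_pair_trans (pair_comm x u ▸ hM.2.2) hM'.2.2 (hne hu).symm (hne hw) huw)
  rw [partialSimpleSum, ← Finset.sum_filter_not_add_sum_filter _
    (fun M ↦ (M ↾ (↑(insert x U) : Set α)).IsSimple), Finset.filter_filter, Finset.filter_filter,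
    hpair, partialSimpleSum]
  congr 2
  refine Finset.filter_congr fun M hM ↦ ?_
  grind

lemma partialSimpleSum_eq {U E : Finset α} (hU : U.Nonempty) (hUE : U ⊆ E) :
    partialSimpleSum U E = ((E.card - U.card) ! : ℚ[X]) *
      PowerSeries.coeff (E.card - U.card) (expIter genSimpleSP U.card) := by
  classical
  induction hn : E.card - U.card generalizing U E with
  | zero =>
    obtain rfl : U = E := Finset.eq_of_subset_of_card_le hUE (Nat.sub_eq_zero_iff_le.1 hn)
    rw [PowerSeries.coeff_zero_eq_constantCoeff_apply, constantCoeff_expIter, Nat.factorial_zero,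
      Nat.cast_one, one_mul, ← sum_isSeriesParallel_and_isSimple, partialSimpleSum]
    refine Finset.sum_congr (Finset.filter_congr fun M hM ↦ ?_) fun _ _ ↦ rfl
    rw [← mem_matroidsOn.1 hM, restrict_ground_eq_self]
  | succ n ih =>
    obtain ⟨x, hx, hxU⟩ := Finset.exists_mem_notMem_of_card_lt_card (s := U) (t := E) (by omega)
    obtain ⟨E, hxE, rfl⟩ : ∃ E', x ∉ E' ∧ insert x E' = E :=
      ⟨E.erase x, Finset.notMem_erase x E, Finset.insert_erase hx⟩
    have hUE' : U ⊆ E := (Finset.subset_insert_iff_of_notMem hxU).1 hUE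
    rw [Finset.card_insert_of_notMem hxE] at hn
    have hcoeff := congrArg (PowerSeries.coeff n) (derivative_expIter genSimpleSP U.card)
    rw [PowerSeries.coeff_derivative, map_add, ← map_natCast (PowerSeries.C (R := ℚ[X])),
      PowerSeries.coeff_C_mul] at hcoeff
    rw [partialSimpleSum_insert hU hUE' hxE, ih hU hUE' (by omega),
      ih (Finset.insert_nonempty x U) (Finset.insert_subset_insert x hUE')
        (by rw [Finset.card_insert_of_notMem hxE, Finset.card_insert_of_notMem hxU]; omega),
      Finset.card_insert_of_notMem hxU, Nat.factorial_succ]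
    push_cast
    linear_combination (-(n ! : ℚ[X])) * hcoeff

end Simplification

section Substitution

variable {M : Matroid α} {e : α}

lemma restrict_singleton_isSimple_iff (he : e ∈ M.E) : (M ↾ {e}).IsSimple ↔ ¬ M.IsLoop e := by
  simp [restrict_isSimple_iff (singleton_subset_iff.2 he), singleton_isCircuit]

lemma IsConn.isLoop_iff (hM : IsConn M) : M.IsLoop e ↔ M = loopyOn {e} := by
  refine ⟨fun hl ↦ ?_, fun h ↦ by simp [h]⟩
  have hE : M.E = {e} := (not_nontrivial_iff.1 fun hnt ↦
    (hM.isNonloop hnt hl.mem_ground).not_isLoop hl).eq_singleton_of_mem hl.mem_ground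
  rw [← hE, ← closure_empty_eq_ground_iff]
  exact (closure_subset_ground M ∅).antisymm (by simpa [hE] using hl.mem_closure ∅)

open Classical in
lemma sum_isSeriesParallel_eq_partialSimpleSum_add [DecidableEq α] {E : Finset α} (he : e ∈ E) :
    ∑ M ∈ matroidsOn E with M.IsSeriesParallel, rankMonomial M =
      partialSimpleSum {e} E + if E = {e} then 1 else 0 := by
  rw [← Finset.sum_filter_add_sum_filter_not _ (fun M ↦ (M ↾ {e}).IsSimple), Finset.filter_filter,
    Finset.filter_filter, partialSimpleSum, Finset.coe_singleton]
  have hiff {M : Matroid α} : (M.E = E ∧ M.IsSeriesParallel ∧ ¬ (M ↾ {e}).IsSimple) ↔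
      E = {e} ∧ M = loopyOn {e} := by
    refine ⟨fun ⟨hE, hSP, hS⟩ ↦ ?_, ?_⟩
    · rw [restrict_singleton_isSimple_iff (by simpa [hE] using he), not_not,
        (isConn_of_isSeriesParallel hSP).isLoop_iff] at hS
      subst hS
      exact ⟨by simpa [eq_comm] using hE, rfl⟩
    · rintro ⟨rfl, rfl⟩
      rw [restrict_singleton_isSimple_iff (M := loopyOn {e}) rfl]
      simp [IsSeriesParallel.loop]
  have hfilter : {M ∈ matroidsOn E | M.IsSeriesParallel ∧ ¬ (M ↾ {e}).IsSimple} =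
      if E = {e} then {loopyOn {e}} else ∅ := by
    ext M
    rw [Finset.mem_filter, mem_matroidsOn, hiff]
    split_ifs with h <;> simp [h]
  rw [hfilter]
  split_ifs <;> simp [rankMonomial]

lemma derivative_genC : PowerSeries.derivative ℚ[X] genC = 1 + expIter genSimpleSP 1 := by
  ext1 n
  have h := sum_isSeriesParallel_eq_partialSimpleSum_add (Finset.mem_univ (0 : Fin (n + 1)))
  rw [sum_isSeriesParallel, partialSimpleSum_eq (Finset.singleton_nonempty _)
    (Finset.subset_univ _), Finset.card_fin, Finset.card_singleton, Nat.add_sub_cancel] at h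
  have hone : (if (Finset.univ : Finset (Fin (n + 1))) = {0} then 1 else 0 : ℚ[X]) =
      (n ! : ℚ[X]) * PowerSeries.coeff n 1 := by
    cases n <;> simp [PowerSeries.coeff_one, Finset.ext_iff, Fin.forall_fin_succ]
  rw [hone, Nat.factorial_succ] at h
  push_cast at h
  refine mul_left_cancel₀ (Nat.cast_ne_zero.2 n.factorial_ne_zero) ?_
  rw [PowerSeries.coeff_derivative, map_add]
  linear_combination h

lemma genC_eq : genC = PowerSeries.X + genSimpleSP.subst (PowerSeries.exp ℚ[X] - 1) := by
  have hzero : expIter genSimpleSP 0 = genSimpleSP.subst (PowerSeries.exp ℚ[X] - 1) := by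
    simp [expIter]
  rw [← hzero]
  refine PowerSeries.derivative.ext ?_ ?_
  · rw [derivative_genC, map_add, PowerSeries.derivative_X, derivative_expIter]
    simp
  · simp [constantCoeff_genC, constantCoeff_expIter, constantCoeff_genSimpleSP]

lemma genA_subst_logOf {f : ℚ[X]⟦X⟧} (hf : PowerSeries.constantCoeff f = 1) :
    genA.subst (PowerSeries.logOf f) =
      f * (PowerSeries.exp ℚ[X]).subst (genSimpleSP.subst (f - 1)) := by
  have hlog : PowerSeries.HasSubst (PowerSeries.logOf f) :=
    .of_constantCoeff_zero' (PowerSeries.constantCoeff_logOf hf)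
  have hf₀ : PowerSeries.constantCoeff (f - 1) = 0 := by simp [hf]
  have hC : genC.subst (PowerSeries.logOf f) =
      PowerSeries.logOf f + genSimpleSP.subst (f - 1) := by
    rw [genC_eq, PowerSeries.subst_add hlog, PowerSeries.subst_X hlog,
      PowerSeries.subst_comp_subst_apply PowerSeries.HasSubst.exp_sub_one hlog,
      PowerSeries.subst_sub hlog, one_subst hlog, exp_subst_logOf hf]
  rw [genA, PowerSeries.subst_comp_subst_apply (.of_constantCoeff_zero' constantCoeff_genC) hlog,
    hC, exp_subst_add (PowerSeries.constantCoeff_logOf hf) (by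
      rw [constantCoeff_subst_of_constantCoeff_eq_zero _ hf₀, constantCoeff_genSimpleSP]),
    exp_subst_logOf hf]

lemma invOfUnit_mul_genA_subst_logOf (q : ℕ) :
    PowerSeries.invOfUnit (1 + (q : ℚ[X]⟦X⟧) * PowerSeries.X) 1 *
        genA.subst (PowerSeries.logOf (1 + (q : ℚ[X]⟦X⟧) * PowerSeries.X)) =
      PowerSeries.rescale (q : ℚ[X]) genS := by
  rw [genA_subst_logOf (by simp), ← mul_assoc, PowerSeries.invOfUnit_mul _ _ (by simp), one_mul,
    add_sub_cancel_left, genS_eq,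
    rescale_subst _ (.of_constantCoeff_zero' constantCoeff_genSimpleSP),
    PowerSeries.rescale_eq_subst, PowerSeries.smul_eq_C_mul, map_natCast]

lemma genSG_eq_ratPow (G : Type*) [Group G] [Finite G] :
    genSG G = ratPow (PowerSeries.rescale (Nat.card G : ℚ[X]) genS) (1 / (Nat.card G : ℚ)) := by
  rw [genSG_eq, genS_eq, rescale_subst _ (.of_constantCoeff_zero' constantCoeff_genSimpleSP),
    ratPow, binomialSeries_subst_exp_subst
      ((constantCoeff_rescale _ _).trans constantCoeff_genSimpleSP)]

end Substitution

end SeriesParallel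

/-- `PowerSeries.logOf f` is `log f`; `PowerSeries.invOfUnit f 1` is `1 / f` for a power series `f`
with constant coefficient `1`; `f.subst g` is `f(g(x), y)`, and `rescale q f` is `f(q x, y)`. -/
theorem proposition3p3 (G : Type*) [Group G] [Finite G] (q : ℕ) (hq : q = Nat.card G) :
    genSG G =
      ratPow
        (PowerSeries.invOfUnit (1 + (q : ℚ[X]⟦X⟧) * PowerSeries.X) 1 *
          genA.subst (PowerSeries.logOf (1 + (q : ℚ[X]⟦X⟧) * PowerSeries.X)))
        (1 / (q : ℚ)) ∧
    genSG G = ratPow (PowerSeries.rescale (q : ℚ[X]) genS) (1 / (q : ℚ)) := by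
  subst hq
  rw [SeriesParallel.invOfUnit_mul_genA_subst_logOf]
  exact ⟨SeriesParallel.genSG_eq_ratPow G, SeriesParallel.genSG_eq_ratPow G⟩
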